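/- **Theorem.** An instance of capacitated domination is a finite simple graph $G=(V,E)$ on $n$ vertices with a nonnegative real cost $w(v)$, capacity $c(v)$ and demand $d(v)$ at every vertex $v$. With $N[v]$ the closed neighbourhood of $v$, a demand assignment $f:V\times V\to\mathbb R_{\ge 0}$ is feasible if $\sum_{u\in N[v]}f(v,u)\ge d(v)$ for every $v$, where nothing may be assigned to a vertex of capacity $0$ (if $c(v)=0$ then $f(u,v)=0$ for all $u\in N[v]$). Its cost is $w(f)=\sum_{v}w(v)\,x_f(v)$ with $x_f(v)=\left\lceil \sum_{u\in N[v]}f(u,v)/c(v)\right\rceil$ (and $x_f(v)=0$ if $c(v)=0$). If a feasible assignment exists, $OPT(G)$ is the infimum of $w(f)$ over all feasible $f$. A graph is outerplanar if it can be drawn with distinct vertices on a circle and with edges as straight segments so that two distinct edges meet only at common endpoints. There is an algorithm that, given the list of edges (in any order) of an outerplanar graph $G$ on $n$ vertices together with $w$, $c$, $d$, halts after $O(n^2)$ steps and, whenever the instance has a feasible demand assignment, outputs a feasible demand assignment $f$ with $$w(f)\le 36\cdot OPT(G).$$ Here an algorithm is one fixed program for a real random access machine with unit-cost arithmetic $+,-,\times,/$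 and comparisons on exact reals (rational constants, no rounding), and unit-cost addition, truncated subtraction, multiplication, comparison and array access on words of $O(\log n)$ bits. No embedding of $G$ is given. The bound $O(n^2)$ means at most $K(n^2+1)$ steps for a constant $K$ independent of the instance. -/

import Mathlib

namespace CapDom

/-! ### Outerplanar graphs -/

/-- `G` has a drawing in the plane with distinct vertices on a circle and straight edges, in which
two different edges meet only at common endpoints. -/
def IsOuterplanar {V : Type*} (G : SimpleGraph V) : Prop :=
  ∃ p : V → ℂ, Function.Injective p ∧ (∀ v, ‖p v‖ = 1) ∧
    ∀ u v x y, G.Adj u v → G.Adj x y → s(u, v) ≠ s(x, y) →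
      segment ℝ (p u) (p v) ∩ segment ℝ (p x) (p y) ⊆ p '' ({u, v} ∩ {x, y})

/-! ### Capacitated domination -/

/-- A simple graph with a nonnegative cost, capacity and demand at every vertex. -/
structure Instance (V : Type*) where
  graph : SimpleGraph V
  cost : V → ℝ
  cap : V → ℝ
  demand : V → ℝ
  cost_nonneg : ∀ v, 0 ≤ cost v
  cap_nonneg : ∀ v, 0 ≤ cap v
  demand_nonneg : ∀ v, 0 ≤ demand v

section Problem

variable {V : Type*} [Fintype V]

open Classical in
/-- The closed neighbourhood `N[v]`. -/
noncomputable def closedNbhd (G : SimpleGraph V) (v : V) : Finset V :=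
  insert v (G.neighborFinset v)

/-- `f u v` is the amount of the demand of `u` that is assigned to `v`. Copies of a vertex of
capacity zero provide no service, so nothing can be assigned to such a vertex. -/
structure Instance.IsFeasible (I : Instance V) (f : V → V → ℝ) : Prop where
  nonneg : ∀ u v, 0 ≤ f u v
  demand_le : ∀ v, I.demand v ≤ ∑ u ∈ closedNbhd I.graph v, f v u
  cap_zero : ∀ v, I.cap v = 0 → ∀ u ∈ closedNbhd I.graph v, f u v = 0

/-- The multiplicity `x_f(v)` (for feasible `f` it is `0` when `v` has capacity zero). -/
noncomputable def Instance.multiplicity (I : Instance V) (f : V → V → ℝ) (v : V) : ℕ :=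
  ⌈(∑ u ∈ closedNbhd I.graph v, f u v) / I.cap v⌉₊

/-- The cost `w(f)` of a demand assignment. -/
noncomputable def Instance.assignmentCost (I : Instance V) (f : V → V → ℝ) : ℝ :=
  ∑ v, I.cost v * I.multiplicity f v

/-- The least cost of a feasible demand assignment (meaningful when there is one). -/
noncomputable def Instance.OPT (I : Instance V) : ℝ :=
  sInf {r | ∃ f, I.IsFeasible f ∧ I.assignmentCost f = r}

end Problem

/-! ### A real random access machine with unit cost

Programs are fixed and finite, so each uses finitely many registers and finitely many arrays, of
two kinds: words (natural numbers at most `B`) and exact real numbers. Arrays are accessed with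
indirect addressing. There is no conversion, rounding or floor operation from reals to words. -/

structure State where
  ireg : ℕ → ℕ
  rreg : ℕ → ℝ
  iarr : ℕ → ℕ → ℕ
  rarr : ℕ → ℕ → ℝ

inductive Instr where
  | iconst (x k : ℕ)
  | iadd (x y z : ℕ)
  | isub (x y z : ℕ)
  | imul (x y z : ℕ)
  | iload (x a y : ℕ)
  | istore (a x y : ℕ)
  | rconst (x : ℕ) (q : ℚ)
  | radd (x y z : ℕ)
  | rsub (x y z : ℕ)
  | rmul (x y z : ℕ)
  | rdiv (x y z : ℕ)
  | rload (x a y : ℕ)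
  | rstore (a x y : ℕ)

/-- Write `k` to the word register `x`; the machine gets stuck if `k` does not fit in a word. -/
def State.setI (B : ℕ) (s : State) (x k : ℕ) : Option State :=
  if k ≤ B then some { s with ireg := Function.update s.ireg x k } else none

def State.setR (s : State) (x : ℕ) (r : ℝ) : State :=
  { s with rreg := Function.update s.rreg x r }

open Classical in
/-- The effect of one instruction with word bound `B`; `none` means that the machine is stuck
(word overflow or division by zero). Subtraction of words is truncated at `0`. -/
noncomputable def Instr.eval (B : ℕ) (s : State) : Instr → Option State
  | iconst x k => s.setI B x k
  | iadd x y z => s.setI B x (s.ireg y + s.ireg z)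
  | isub x y z => s.setI B x (s.ireg y - s.ireg z)
  | imul x y z => s.setI B x (s.ireg y * s.ireg z)
  | iload x a y => s.setI B x (s.iarr a (s.ireg y))
  | istore a x y =>
      let A := Function.update (s.iarr a) (s.ireg x) (s.ireg y)
      some { s with iarr := Function.update s.iarr a A }
  | rconst x q => some (s.setR x (q : ℝ))
  | radd x y z => some (s.setR x (s.rreg y + s.rreg z))
  | rsub x y z => some (s.setR x (s.rreg y - s.rreg z))
  | rmul x y z => some (s.setR x (s.rreg y * s.rreg z))
  | rdiv x y z => if s.rreg z = 0 then none else some (s.setR x (s.rreg y / s.rreg z))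
  | rload x a y => some (s.setR x (s.rarr a (s.ireg y)))
  | rstore a x y =>
      let A := Function.update (s.rarr a) (s.ireg x) (s.rreg y)
      some { s with rarr := Function.update s.rarr a A }

/-- Comparisons of two registers. -/
inductive Test where
  | ilt (x y : ℕ)
  | ieq (x y : ℕ)
  | rlt (x y : ℕ)

def Test.holds (s : State) : Test → Prop
  | ilt x y => s.ireg x < s.ireg y
  | ieq x y => s.ireg x = s.ireg y
  | rlt x y => s.rreg x < s.rreg y

inductive Program where
  | skip
  | instr (i : Instr)
  | seq (P Q : Program)
  | ite (b : Test) (P Q : Program)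
  | loop (b : Test) (P : Program)

/-- `Exec B P s s' t`: with word bound `B`, the program `P` started in state `s` halts in state
`s'` after exactly `t` steps. Every instruction and every evaluation of a test is one step. -/
inductive Exec (B : ℕ) : Program → State → State → ℕ → Prop where
  | skip (s : State) : Exec B .skip s s 1
  | instr (i : Instr) (s s' : State) (h : i.eval B s = some s') : Exec B (.instr i) s s' 1
  | seq (P Q : Program) (s s' s'' : State) (t t' : ℕ)
      (hP : Exec B P s s' t) (hQ : Exec B Q s' s'' t') : Exec B (.seq P Q) s s'' (t + t')
  | iteTrue (b : Test) (P Q : Program) (s s' : State) (t : ℕ) (hb : b.holds s)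
      (hP : Exec B P s s' t) : Exec B (.ite b P Q) s s' (t + 1)
  | iteFalse (b : Test) (P Q : Program) (s s' : State) (t : ℕ) (hb : ¬ b.holds s)
      (hQ : Exec B Q s s' t) : Exec B (.ite b P Q) s s' (t + 1)
  | loopTrue (b : Test) (P : Program) (s s' s'' : State) (t t' : ℕ) (hb : b.holds s)
      (hP : Exec B P s s' t) (hL : Exec B (.loop b P) s' s'' t') :
      Exec B (.loop b P) s s'' (t + t' + 1)
  | loopFalse (b : Test) (P : Program) (s : State) (hb : ¬ b.holds s) :
      Exec B (.loop b P) s s 1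

/-- The machine is deterministic. -/
theorem Exec.unique {B : ℕ} {P : Program} {s s₁ s₂ : State} {t₁ t₂ : ℕ}
    (h₁ : Exec B P s s₁ t₁) (h₂ : Exec B P s s₂ t₂) : s₁ = s₂ ∧ t₁ = t₂ := by
  induction h₁ generalizing s₂ t₂ with
  | skip s => cases h₂; simp
  | instr i s s' h => cases h₂ with | instr _ _ _ h' => simp_all
  | seq P Q s s' s'' t t' _ _ ihP ihQ =>
    cases h₂ with
    | seq _ _ _ _ _ _ _ hP hQ =>
      obtain ⟨rfl, rfl⟩ := ihP hP
      obtain ⟨rfl, rfl⟩ := ihQ hQ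
      simp
  | iteTrue b P Q s s' t hb _ ih =>
    cases h₂ with
    | iteTrue _ _ _ _ _ _ _ h => obtain ⟨rfl, rfl⟩ := ih h; simp
    | iteFalse _ _ _ _ _ _ hb' => exact absurd hb hb'
  | iteFalse b P Q s s' t hb _ ih =>
    cases h₂ with
    | iteTrue _ _ _ _ _ _ hb' => exact absurd hb' hb
    | iteFalse _ _ _ _ _ _ _ h => obtain ⟨rfl, rfl⟩ := ih h; simp
  | loopTrue b P s s' s'' t t' hb _ _ ihP ihL =>
    cases h₂ with
    | loopTrue _ _ _ _ _ _ _ _ hP hL =>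
      obtain ⟨rfl, rfl⟩ := ihP hP
      obtain ⟨rfl, rfl⟩ := ihL hL
      simp
    | loopFalse _ _ _ hb' => exact absurd hb hb'
  | loopFalse b P s hb =>
    cases h₂ with
    | loopTrue _ _ _ _ _ _ _ hb' => exact absurd hb' hb
    | loopFalse => simp

/-! ### Input and output -/

/-- `L` lists every edge of `G` exactly once, in any order and with endpoints in either order. -/
def IsEdgeList {V : Type*} (G : SimpleGraph V) (L : List (V × V)) : Prop :=
  (L.map fun e => s(e.1, e.2)).Nodup ∧
    ∀ u v, G.Adj u v ↔ s(u, v) ∈ L.map fun e => s(e.1, e.2)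

/-- The initial state: the number of vertices and of edges in word registers `0` and `1`, the
endpoints of the `i`-th edge at place `i` of word arrays `0` and `1`, and the costs, capacities
and demands in real arrays `0`, `1` and `2`. Everything else is zero. -/
noncomputable def encode {n : ℕ} (I : Instance (Fin n)) (L : List (Fin n × Fin n)) : State where
  ireg x := if x = 0 then n else if x = 1 then L.length else 0
  rreg _ := 0
  iarr a i :=
    if a = 0 then L[i]?.elim 0 (fun e => (e.1 : ℕ))
    else if a = 1 then L[i]?.elim 0 (fun e => (e.2 : ℕ))
    else 0
  rarr a i :=
    if h : i < n then
      if a = 0 then I.cost ⟨i, h⟩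
      else if a = 1 then I.cap ⟨i, h⟩
      else if a = 2 then I.demand ⟨i, h⟩
      else 0
    else 0

/-- The demand assignment that a final state holds, as an `n × n` matrix in real array `3`. -/
def decode (n : ℕ) (s : State) (u v : Fin n) : ℝ := s.rarr 3 (u * n + v)

end CapDom

/-! The algorithm is a one-pass primal-dual scheme that ignores outerplanarity; the geometry enters
only in the analysis. Vertices `v` of positive demand are treated in turn. The dual value `α v` is
the least price of a neighbour `u` of positive capacity, namely `d(v) w(u)/c(u)` plus the smaller of
the part of `w(u)` not yet paid and `w(u)/7`. The cheapest `u` becomes the server of `v`, and each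
possible server is then paid the excess of `α v` over the service cost there.

Lower bound (`Instance.PrimalDual.sum_le`): for any feasible `g`, average `α v` over the vertices to
which `g` sends demand of `v`. The service parts sum to at most `w(g)`. So do the payments, since no
vertex collects more than its cost and only vertices opened by `g` count. Hence `∑ α ≤ 2 w(g)`.

Upper bound (`Instance.PrimalDual.assignmentCost_le`): rounding up costs one extra copy of each
server `u`. Orient the graph with outdegrees at most 3 (`IsOuterplanar.exists_orientation`). If some
client of `u` paid `w(u)/7`, seven times the clients' payments cover the copy. Otherwise `u` is
fully paid, and its at most 3 out-neighbours gave at most `3w(u)/7`, so the other payers, namely `u`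
itself and in-neighbours, gave at least `4w(u)/7`. Each vertex is charged in this second way only by
itself and its at most 3 out-neighbours. Altogether `w(f) ≤ 14 ∑ α ≤ 28 OPT`, within the claimed 36.

With an adjacency matrix, each vertex is treated in linear time, so the running time is quadratic.
-/

namespace CapDom

/-! ### Orientations of outerplanar graphs -/

/-- Coordinate of a point of the unit circle under stereographic projection from `-1`. -/
noncomputable def circleCoord (z : ℂ) : ℝ := z.im / (1 + z.re)

/-- `circleCoord` is the tangent of half the argument, so these are the half-angle formulas. They
turn statements about points of the circle into polynomial identities in one real parameter. At `-1`
the quotient takes the default value 0, the coordinate of the point 1, so that point must be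
excluded. -/
theorem circle_eq_of_ne {z : ℂ} (hz : ‖z‖ = 1) (h : z ≠ -1) :
    z.re = (1 - circleCoord z ^ 2) / (1 + circleCoord z ^ 2) ∧
      z.im = 2 * circleCoord z / (1 + circleCoord z ^ 2) := by
  have h1 : z.re ^ 2 + z.im ^ 2 = 1 := by
    have := Complex.sq_norm z
    rw [hz, Complex.normSq_apply] at this
    linarith
  have h2 : 1 + z.re ≠ 0 := by
    intro h0
    apply h
    have hre : z.re = -1 := by linarith
    have him : z.im = 0 := by
      rw [hre] at h1
      nlinarith
    apply Complex.ext <;> simp [hre, him]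
  have hne : (1 + z.re) ^ 2 + z.im ^ 2 ≠ 0 := by positivity
  have e : 1 + circleCoord z ^ 2 = 2 / (1 + z.re) := by
    unfold circleCoord
    field_simp
    linarith
  rw [e]
  unfold circleCoord
  constructor
  · field_simp
    linear_combination h1
  · field_simp

theorem circleCoord_injOn {z z' : ℂ} (hz : ‖z‖ = 1) (h : z ≠ -1) (hz' : ‖z'‖ = 1) (h' : z' ≠ -1)
    (e : circleCoord z = circleCoord z') : z = z' := by
  obtain ⟨a, b⟩ := circle_eq_of_ne hz h
  obtain ⟨a', b'⟩ := circle_eq_of_ne hz' h'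
  apply Complex.ext
  · rw [a, a', e]
  · rw [b, b', e]

/-- Two chords of the unit circle whose endpoints alternate intersect. -/
theorem chords_inter_nonempty {a b c d : ℂ} (ha : ‖a‖ = 1) (hb : ‖b‖ = 1) (hc : ‖c‖ = 1)
    (hd : ‖d‖ = 1) (ha' : a ≠ -1) (hb' : b ≠ -1) (hc' : c ≠ -1) (hd' : d ≠ -1)
    (hab : circleCoord a < circleCoord b) (hbc : circleCoord b < circleCoord c)
    (hcd : circleCoord c < circleCoord d) :
    (segment ℝ a c ∩ segment ℝ b d).Nonempty := by
  obtain ⟨ar, ai⟩ := circle_eq_of_ne ha ha'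
  obtain ⟨br, bi⟩ := circle_eq_of_ne hb hb'
  obtain ⟨cr, ci⟩ := circle_eq_of_ne hc hc'
  obtain ⟨dr, di⟩ := circle_eq_of_ne hd hd'
  generalize circleCoord a = t₁ at *
  generalize circleCoord b = t₂ at *
  generalize circleCoord c = t₃ at *
  generalize circleCoord d = t₄ at *
  have h12 : 0 < t₂ - t₁ := by linarith
  have h13 : 0 < t₃ - t₁ := by linarith
  have h14 : 0 < t₄ - t₁ := by linarith
  have h23 : 0 < t₃ - t₂ := by linarith
  have h24 : 0 < t₄ - t₂ := by linarith
  have h34 : 0 < t₄ - t₃ := by linarith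
  have q1 : 0 < 1 + t₁ ^ 2 := by positivity
  have q2 : 0 < 1 + t₂ ^ 2 := by positivity
  have q3 : 0 < 1 + t₃ ^ 2 := by positivity
  have q4 : 0 < 1 + t₄ ^ 2 := by positivity
  -- The `Mᵢ` are the 3 × 3 Vandermonde minors of the four parameters. Hence `M₁ q(t₁) + M₃ q(t₃) =
  -- M₂ q(t₂) + M₄ q(t₄)` for every quadratic polynomial `q`. Taking `q` to be `1 + t²`, `1 - t²`
  -- and `2t` shows that two convex combinations, one on each chord, are the same point.
  set M₁ := (t₃ - t₂) * (t₄ - t₂) * (t₄ - t₃) with hM1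
  set M₂ := (t₃ - t₁) * (t₄ - t₁) * (t₄ - t₃) with hM2
  set M₃ := (t₂ - t₁) * (t₄ - t₁) * (t₄ - t₂) with hM3
  set M₄ := (t₂ - t₁) * (t₃ - t₁) * (t₃ - t₂) with hM4
  have m1 : 0 < M₁ := by positivity
  have m2 : 0 < M₂ := by positivity
  have m3 : 0 < M₃ := by positivity
  have m4 : 0 < M₄ := by positivity
  set S := M₁ * (1 + t₁ ^ 2) + M₃ * (1 + t₃ ^ 2) with hS
  have hS' : S = M₂ * (1 + t₂ ^ 2) + M₄ * (1 + t₄ ^ 2) := by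
    simp only [hS, hM1, hM2, hM3, hM4]; ring
  have sp : 0 < S := by positivity
  have are : M₁ * (1 + t₁ ^ 2) * a.re = M₁ * (1 - t₁ ^ 2) := by rw [ar]; field_simp
  have bre : M₂ * (1 + t₂ ^ 2) * b.re = M₂ * (1 - t₂ ^ 2) := by rw [br]; field_simp
  have cre : M₃ * (1 + t₃ ^ 2) * c.re = M₃ * (1 - t₃ ^ 2) := by rw [cr]; field_simp
  have dre : M₄ * (1 + t₄ ^ 2) * d.re = M₄ * (1 - t₄ ^ 2) := by rw [dr]; field_simp
  have aim : M₁ * (1 + t₁ ^ 2) * a.im = M₁ * (2 * t₁) := by rw [ai]; field_simp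
  have bim : M₂ * (1 + t₂ ^ 2) * b.im = M₂ * (2 * t₂) := by rw [bi]; field_simp
  have cim : M₃ * (1 + t₃ ^ 2) * c.im = M₃ * (2 * t₃) := by rw [ci]; field_simp
  have dim : M₄ * (1 + t₄ ^ 2) * d.im = M₄ * (2 * t₄) := by rw [di]; field_simp
  refine ⟨(M₁ * (1 + t₁ ^ 2) / S) • a + (M₃ * (1 + t₃ ^ 2) / S) • c,
    ⟨_, _, by positivity, by positivity, ?_, rfl⟩,
    ⟨M₂ * (1 + t₂ ^ 2) / S, M₄ * (1 + t₄ ^ 2) / S, by positivity, by positivity, ?_, ?_⟩⟩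
  · rw [← add_div, ← hS, div_self sp.ne']
  · rw [← add_div, ← hS', div_self sp.ne']
  · apply Complex.ext
    · simp only [Complex.add_re, Complex.smul_re, smul_eq_mul, div_mul_eq_mul_div, are, bre, cre,
        dre, ← add_div]
      congr 1
      simp only [hM1, hM2, hM3, hM4]; ring
    · simp only [Complex.add_im, Complex.smul_im, smul_eq_mul, div_mul_eq_mul_div, aim, bim, cim,
        dim, ← add_div]
      congr 1
      simp only [hM1, hM2, hM3, hM4]; ring

/-- An outerplanar graph has an orientation with outdegrees at most three. -/
theorem IsOuterplanar.exists_orientation {V : Type*} [Fintype V] {G : SimpleGraph V}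
    (hG : IsOuterplanar G) :
    ∃ O : V → Finset V, (∀ v, (O v).card ≤ 3) ∧ ∀ u v, G.Adj u v → v ∈ O u ∨ u ∈ O v := by
  classical
  obtain ⟨p, hp, hp1, hcross⟩ := hG
  set t : V → ℝ := fun v => circleCoord (p v) with ht
  have tinj : ∀ x y, p x ≠ -1 → p y ≠ -1 → t x = t y → x = y := fun x y hx hy e =>
    hp (circleCoord_injOn (hp1 x) hx (hp1 y) hy e)
  -- The out-neighbours of `v` are its rightmost and its leftmost neighbour in the coordinate `t`,
  -- together with the at most one vertex placed at `-1`, where `t` is meaningless.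
  let X : Finset V := Finset.univ.filter fun x => p x = -1
  let R : V → Finset V := fun v => Finset.univ.filter fun x =>
    p x ≠ -1 ∧ G.Adj v x ∧ ∀ y, G.Adj v y → p y ≠ -1 → t y ≤ t x
  let L : V → Finset V := fun v => Finset.univ.filter fun x =>
    p x ≠ -1 ∧ G.Adj v x ∧ ∀ y, G.Adj v y → p y ≠ -1 → t x ≤ t y
  refine ⟨fun v => X ∪ R v ∪ L v, fun v => ?_, ?_⟩
  · have hX : X.card ≤ 1 := Finset.card_le_one.2 fun x hx y hy => by
      simp only [X, Finset.mem_filter, Finset.mem_univ, true_and] at hx hy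
      exact hp (hx.trans hy.symm)
    have hR : (R v).card ≤ 1 := Finset.card_le_one.2 fun x hx y hy => by
      simp only [R, Finset.mem_filter, Finset.mem_univ, true_and] at hx hy
      exact tinj x y hx.1 hy.1 (le_antisymm (hy.2.2 x hx.2.1 hx.1) (hx.2.2 y hy.2.1 hy.1))
    have hL : (L v).card ≤ 1 := Finset.card_le_one.2 fun x hx y hy => by
      simp only [L, Finset.mem_filter, Finset.mem_univ, true_and] at hx hy
      exact tinj x y hx.1 hy.1 (le_antisymm (hx.2.2 y hy.2.1 hy.1) (hy.2.2 x hx.2.1 hx.1))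
    have h1 := Finset.card_union_le (X ∪ R v) (L v)
    have h2 := Finset.card_union_le X (R v)
    change (X ∪ R v ∪ L v).card ≤ 3
    omega
  -- If `v` is not the rightmost neighbour of `u` and `u` is not the leftmost neighbour of `v`,
  -- there are edges `uy` and `xv` with `x < u < v < y`. These chords cross although they share no
  -- endpoint.
  · have key : ∀ u v, G.Adj u v → p u ≠ -1 → p v ≠ -1 → t u < t v → v ∈ R u ∨ u ∈ L v := by
      intro u v huv hu hv hlt
      by_contra! hcon
      obtain ⟨h1, h2⟩ := hcon
      simp only [R, L, Finset.mem_filter, Finset.mem_univ, true_and, not_and, not_forall,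
        not_le] at h1 h2
      obtain ⟨y, hy, hy1, hty⟩ := h1 hv huv
      obtain ⟨x, hx, hx1, htx⟩ := h2 hu huv.symm
      obtain ⟨z, hz⟩ := chords_inter_nonempty (hp1 x) (hp1 u) (hp1 v) (hp1 y) hx1 hu hv hy1
        htx hlt hty
      have hxu : x ≠ u := by rintro rfl; exact lt_irrefl _ htx
      have hxy : x ≠ y := by rintro rfl; exact lt_irrefl _ (htx.trans (hlt.trans hty))
      have hvu : v ≠ u := by rintro rfl; exact lt_irrefl _ hlt
      have hvy : v ≠ y := by rintro rfl; exact lt_irrefl _ hty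
      have := hcross x v u y hx.symm hy (by simp [hxu, hxy]) hz
      obtain ⟨q, ⟨hq1, hq2⟩, -⟩ := this
      simp only [Set.mem_insert_iff, Set.mem_singleton_iff] at hq1 hq2
      rcases hq1 with rfl | rfl <;> rcases hq2 with h | h <;> contradiction
    intro u v huv
    by_cases hu : p u = -1
    · right; simp [X, hu]
    by_cases hv : p v = -1
    · left; simp [X, hv]
    rcases lt_trichotomy (t u) (t v) with h | h | h
    · rcases key u v huv hu hv h with h | h <;> simp [h]
    · exact absurd (tinj u v hu hv h) huv.ne
    · rcases key v u huv.symm hv hu h with h | h <;> simp [h]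

/-! ### Primal-dual solutions -/

section PrimalDual

variable {V : Type*}

/-- The cost of serving one unit of demand at `u`, apart from rounding. -/
noncomputable def Instance.rate (I : Instance V) (u : V) : ℝ := I.cost u / I.cap u

theorem Instance.rate_nonneg (I : Instance V) (u : V) : 0 ≤ I.rate u :=
  div_nonneg (I.cost_nonneg u) (I.cap_nonneg u)

/-- What `v` with dual value `a` contributes to opening `u`. -/
noncomputable def Instance.bid (I : Instance V) (v : V) (a : ℝ) (u : V) : ℝ :=
  max 0 (a - I.demand v * I.rate u)

theorem Instance.bid_nonneg (I : Instance V) (v : V) (a : ℝ) (u : V) : 0 ≤ I.bid v a u :=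
  le_max_left _ _

variable [Fintype V]

theorem mem_closedNbhd {G : SimpleGraph V} {u v : V} :
    u ∈ closedNbhd G v ↔ u = v ∨ G.Adj v u := by
  classical
  simp [closedNbhd]

theorem mem_closedNbhd_comm {G : SimpleGraph V} {u v : V} :
    u ∈ closedNbhd G v ↔ v ∈ closedNbhd G u := by
  rw [mem_closedNbhd, mem_closedNbhd, eq_comm, G.adj_comm]

open Classical in
/-- The sum of the contributions to `u` from the vertices in `T`. -/
noncomputable def Instance.payment (I : Instance V) (T : Finset V) (α : V → ℝ) (u : V) : ℝ :=
  ∑ v ∈ T with u ∈ closedNbhd I.graph v, I.bid v (α v) u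

/-- Dual values `α` on `T`, with servers `σ`, as maintained by the algorithm. -/
structure Instance.PrimalDual (I : Instance V) (T : Finset V) (α : V → ℝ) (σ : V → V) : Prop where
  demand_pos : ∀ v ∈ T, 0 < I.demand v
  mem : ∀ v ∈ T, σ v ∈ closedNbhd I.graph v
  cap_pos : ∀ v ∈ T, 0 < I.cap (σ v)
  le_dual : ∀ v ∈ T, I.demand v * I.rate (σ v) ≤ α v
  dual_le : ∀ v ∈ T, ∀ u ∈ closedNbhd I.graph v, 0 < I.cap u →
    α v ≤ I.demand v * I.rate u + I.cost u / 7
  payment_le : ∀ u, 0 < I.cap u → I.payment T α u ≤ I.cost u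
  tight : ∀ v ∈ T, I.demand v * I.rate (σ v) + I.cost (σ v) / 7 ≤ α v ∨
    I.cost (σ v) ≤ I.payment T α (σ v)

open Classical in
theorem Instance.payment_insert [inst : DecidableEq V] (I : Instance V) {T : Finset V} (α : V → ℝ) {v : V} (hv : v ∉ T)
    (a : ℝ) (u : V) :
    I.payment (insert v T) (Function.update α v a) u =
      I.payment T α u + if u ∈ closedNbhd I.graph v then I.bid v a u else 0 := by
  cases Subsingleton.elim inst fun a b => Classical.propDecidable (a = b)
  have h : ∑ x ∈ T with u ∈ closedNbhd I.graph x, I.bid x (Function.update α v a x) u =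
      I.payment T α u := by
    refine Finset.sum_congr rfl fun x hx => ?_
    have : x ≠ v := by rintro rfl; exact hv (Finset.mem_filter.1 hx).1
    rw [Function.update_of_ne this]
  rw [← h]
  unfold payment
  rw [Finset.filter_insert]
  split_ifs with hu
  · rw [Finset.sum_insert (by simp [hv]), Function.update_self, add_comm]
  · rw [add_zero]

theorem Instance.PrimalDual.empty (I : Instance V) (α : V → ℝ) (σ : V → V) :
    I.PrimalDual ∅ α σ := by
  constructor <;> simp [payment, I.cost_nonneg]

/-- Since `a` is a minimum over all possible servers, it respects both upper bounds (`dual_le` and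
`payment_le`) at every one of them, and it attains one of the two at `u₀`, which is `tight`.
Payments only grow, so tightness of earlier servers persists. -/
theorem Instance.PrimalDual.insert [DecidableEq V] {I : Instance V} {T : Finset V} {α : V → ℝ} {σ : V → V}
    (h : I.PrimalDual T α σ) {v u₀ : V} {a : ℝ} (hv : v ∉ T) (hd : 0 < I.demand v)
    (hu₀ : u₀ ∈ closedNbhd I.graph v) (hc : 0 < I.cap u₀)
    (ha : a = I.demand v * I.rate u₀ + min (I.cost u₀ - I.payment T α u₀) (I.cost u₀ / 7))
    (hmin : ∀ u ∈ closedNbhd I.graph v, 0 < I.cap u →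
      a ≤ I.demand v * I.rate u + min (I.cost u - I.payment T α u) (I.cost u / 7)) :
    I.PrimalDual (insert v T) (Function.update α v a) (Function.update σ v u₀) := by
  have hmono : ∀ u, I.payment T α u ≤ I.payment (Insert.insert v T) (Function.update α v a) u := by
    intro u
    rw [I.payment_insert α hv]
    have := I.bid_nonneg v a u
    split_ifs <;> linarith
  have hle : I.demand v * I.rate u₀ ≤ a := by
    have h1 := h.payment_le u₀ hc
    have h2 := I.cost_nonneg u₀
    have : 0 ≤ min (I.cost u₀ - I.payment T α u₀) (I.cost u₀ / 7) :=
      le_min (by linarith) (by linarith)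
    linarith
  have hne : ∀ x ∈ T, x ≠ v := by rintro x hx rfl; exact hv hx
  refine ⟨?_, ?_, ?_, ?_, ?_, ?_, ?_⟩
  · exact (Finset.forall_mem_insert _ _ _).2 ⟨hd, h.demand_pos⟩
  · refine (Finset.forall_mem_insert _ _ _).2 ⟨by simpa using hu₀, fun x hx => ?_⟩
    rw [Function.update_of_ne (hne x hx)]; exact h.mem x hx
  · refine (Finset.forall_mem_insert _ _ _).2 ⟨by simpa using hc, fun x hx => ?_⟩
    rw [Function.update_of_ne (hne x hx)]; exact h.cap_pos x hx
  · refine (Finset.forall_mem_insert _ _ _).2 ⟨by simpa using hle, fun x hx => ?_⟩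
    rw [Function.update_of_ne (hne x hx), Function.update_of_ne (hne x hx)]; exact h.le_dual x hx
  · refine (Finset.forall_mem_insert _ _ _).2 ⟨fun u hu hcu => ?_, fun x hx => ?_⟩
    · rw [Function.update_self]
      exact (hmin u hu hcu).trans (by gcongr; exact min_le_right _ _)
    · rw [Function.update_of_ne (hne x hx)]; exact h.dual_le x hx
  · intro u hcu
    rw [I.payment_insert α hv]
    have h1 := h.payment_le u hcu
    split_ifs with hu
    · have h2 := (hmin u hu hcu).trans (add_le_add_right (min_le_left _ _) _)
      have : I.bid v a u ≤ I.cost u - I.payment T α u := max_le (by linarith) (by linarith)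
      linarith
    · linarith
  · refine (Finset.forall_mem_insert _ _ _).2 ⟨?_, fun x hx => ?_⟩
    · rw [Function.update_self, Function.update_self, I.payment_insert α hv, if_pos hu₀]
      rcases le_total (I.cost u₀ - I.payment T α u₀) (I.cost u₀ / 7) with hm | hm
      · right
        rw [min_eq_left hm] at ha
        have : a - I.demand v * I.rate u₀ ≤ I.bid v a u₀ := le_max_right _ _
        linarith
      · left
        rw [min_eq_right hm] at ha
        exact ha.ge
    · rw [Function.update_of_ne (hne x hx), Function.update_of_ne (hne x hx)]
      exact (h.tight x hx).imp_right fun h' => h'.trans (hmono _)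

/-- Weak duality. -/
theorem Instance.PrimalDual.sum_le {I : Instance V} {T : Finset V} {α : V → ℝ} {σ : V → V}
    (h : I.PrimalDual T α σ) {g : V → V → ℝ} (hg : I.IsFeasible g) :
    ∑ v ∈ T, α v ≤ 2 * I.assignmentCost g := by
  classical
  -- Average `α v ≤ d(v) · rate u + bid` with weights `g v u / F`. Because `F ≥ d(v)`, the service
  -- part is at most `g v u · rate u`; because the weight is at most 1, the bid counts at most once,
  -- and only where `g v u > 0`.
  have h1 : ∀ v ∈ T, α v ≤ ∑ u ∈ closedNbhd I.graph v,
      (g v u * I.rate u + if 0 < g v u then I.bid v (α v) u else 0) := by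
    intro v hv
    set F := ∑ u ∈ closedNbhd I.graph v, g v u with hF
    have hdF : I.demand v ≤ F := hg.demand_le v
    have hd := h.demand_pos v hv
    have hFpos : 0 < F := hd.trans_le hdF
    have e : α v = ∑ u ∈ closedNbhd I.graph v, g v u / F * α v := by
      rw [← Finset.sum_mul, ← Finset.sum_div, ← hF, div_self hFpos.ne', one_mul]
    refine e.le.trans (Finset.sum_le_sum fun u hu => ?_)
    have hgu := hg.nonneg v u
    rcases hgu.eq_or_lt with h0 | h0
    · rw [← h0]; simp
    rw [if_pos h0]
    have hle : g v u ≤ F := Finset.single_le_sum (fun x _ => hg.nonneg v x) hu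
    have hb : α v ≤ I.demand v * I.rate u + I.bid v (α v) u := by
      have : α v - I.demand v * I.rate u ≤ I.bid v (α v) u := le_max_right _ _
      linarith
    have hq : g v u / F ≤ 1 := (div_le_one hFpos).2 hle
    have hq0 : 0 ≤ g v u / F := by positivity
    calc g v u / F * α v
        ≤ g v u / F * (I.demand v * I.rate u + I.bid v (α v) u) := by gcongr
      _ = g v u * (I.demand v / F) * I.rate u + g v u / F * I.bid v (α v) u := by ring
      _ ≤ g v u * 1 * I.rate u + 1 * I.bid v (α v) u := by
          have := I.rate_nonneg u
          have := I.bid_nonneg v (α v) u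
          have : I.demand v / F ≤ 1 := (div_le_one hFpos).2 hdF
          gcongr
      _ = _ := by ring
  calc ∑ v ∈ T, α v
      ≤ ∑ v ∈ T, ∑ u ∈ closedNbhd I.graph v,
        (g v u * I.rate u + if 0 < g v u then I.bid v (α v) u else 0) := Finset.sum_le_sum h1
    _ = ∑ u, ∑ v ∈ T with u ∈ closedNbhd I.graph v,
        (g v u * I.rate u + if 0 < g v u then I.bid v (α v) u else 0) := by
        apply Finset.sum_comm'
        simp
    _ ≤ ∑ u, 2 * (I.cost u * I.multiplicity g u) := by
        refine Finset.sum_le_sum fun u _ => ?_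
        have hw := I.cost_nonneg u
        rcases (I.cap_nonneg u).eq_or_lt with hc | hc
        · have : ∀ v ∈ T.filter (fun v => u ∈ closedNbhd I.graph v),
              (g v u * I.rate u + if 0 < g v u then I.bid v (α v) u else 0) = 0 := by
            intro v hv
            rw [hg.cap_zero u hc.symm v (mem_closedNbhd_comm.1 (Finset.mem_filter.1 hv).2)]
            simp
          rw [Finset.sum_eq_zero this]
          positivity
        · rw [Finset.sum_add_distrib, ← Finset.sum_mul]
          have hsub : T.filter (fun v => u ∈ closedNbhd I.graph v) ⊆ closedNbhd I.graph u :=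
            fun v hv => mem_closedNbhd_comm.1 (Finset.mem_filter.1 hv).2
          have hload : ∑ v ∈ T with u ∈ closedNbhd I.graph v, g v u ≤
              ∑ v ∈ closedNbhd I.graph u, g v u :=
            Finset.sum_le_sum_of_subset_of_nonneg hsub fun v _ _ => hg.nonneg v u
          have hceil : (∑ v ∈ closedNbhd I.graph u, g v u) / I.cap u ≤ I.multiplicity g u :=
            Nat.le_ceil _
          have t1 : (∑ v ∈ T with u ∈ closedNbhd I.graph v, g v u) * I.rate u ≤
              I.cost u * I.multiplicity g u := by
            calc _ ≤ (∑ v ∈ closedNbhd I.graph u, g v u) * I.rate u := by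
                  have := I.rate_nonneg u
                  gcongr
              _ = I.cost u * ((∑ v ∈ closedNbhd I.graph u, g v u) / I.cap u) := by
                  unfold rate; ring
              _ ≤ _ := by gcongr
          have t2 : (∑ v ∈ T with u ∈ closedNbhd I.graph v,
              if 0 < g v u then I.bid v (α v) u else 0) ≤ I.cost u * I.multiplicity g u := by
            -- If `g` buys no copy of `u`, nobody sends demand there and no bid counts. Otherwise
            -- all bids together are at most the cost of one copy.
            rcases Nat.eq_zero_or_pos (I.multiplicity g u) with hm | hm
            · have hz : ∀ v ∈ T.filter (fun v => u ∈ closedNbhd I.graph v),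
                  (if 0 < g v u then I.bid v (α v) u else 0) = 0 := by
                intro v hv
                rw [if_neg]
                intro hpos
                have h2 : g v u ≤ ∑ v ∈ closedNbhd I.graph u, g v u :=
                  Finset.single_le_sum (fun x _ => hg.nonneg x u) (hsub hv)
                have h3 : 0 < (∑ v ∈ closedNbhd I.graph u, g v u) / I.cap u :=
                  div_pos (hpos.trans_le h2) hc
                rw [hm] at hceil
                simp only [Nat.cast_zero] at hceil
                linarith
              rw [Finset.sum_eq_zero hz]
              positivity
            · calc _ ≤ I.payment T α u := by
                    refine Finset.sum_le_sum fun v _ => ?_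
                    have := I.bid_nonneg v (α v) u
                    split_ifs <;> linarith
                _ ≤ I.cost u := h.payment_le u hc
                _ ≤ I.cost u * I.multiplicity g u := le_mul_of_one_le_right hw (by exact_mod_cast hm)
          linarith
    _ = 2 * I.assignmentCost g := by rw [assignmentCost, Finset.mul_sum]

/-! ### ### Feasibility and cost of the assignment found -/

open Classical in
/-- Every vertex of `T` assigns its demand to its server. -/
noncomputable def Instance.serve (I : Instance V) (T : Finset V) (σ : V → V) (v u : V) : ℝ :=
  if v ∈ T ∧ u = σ v then I.demand v else 0

theorem Instance.PrimalDual.isFeasible {I : Instance V} {T : Finset V} {α : V → ℝ} {σ : V → V}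
    (h : I.PrimalDual T α σ) (hT : ∀ v, 0 < I.demand v → v ∈ T) : I.IsFeasible (I.serve T σ) := by
  classical
  have h0 : ∀ v u, 0 ≤ I.serve T σ v u := by
    intro v u
    unfold serve
    split_ifs
    · exact I.demand_nonneg v
    · exact le_rfl
  refine ⟨h0, fun v => ?_, fun v hc u hu => ?_⟩
  · rcases (I.demand_nonneg v).eq_or_lt with hd | hd
    · rw [← hd]; exact Finset.sum_nonneg fun u _ => h0 v u
    · have hv := hT v hd
      have : I.serve T σ v (σ v) = I.demand v := by simp [serve, hv]
      rw [← this]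
      exact Finset.single_le_sum (fun x _ => h0 v x) (h.mem v hv)
  · unfold serve
    rw [if_neg]
    rintro ⟨huT, rfl⟩
    exact (h.cap_pos u huT).ne' hc

open Classical in
-- This pays for the extra copy of a server. In the first case of `tight`, the bid of `v` alone is
-- at least a seventh of the cost. In the second, `dual_le` bounds each bid by a seventh of the
-- cost, so the at most 3 out-neighbours of the server contribute at most 3/7 and the remaining
-- payers at least 4/7, whence the factor 7/4.
theorem Instance.PrimalDual.cost_server_le {I : Instance V} {T : Finset V} {α : V → ℝ} {σ : V → V}
    (h : I.PrimalDual T α σ) {O : V → Finset V} (hO : ∀ v, (O v).card ≤ 3)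
    (hadj : ∀ u v, I.graph.Adj u v → v ∈ O u ∨ u ∈ O v) {v : V} (hv : v ∈ T) :
    I.cost (σ v) ≤ 7 / 4 * (∑ x ∈ T with σ v ∈ Insert.insert x (O x), I.bid x (α x) (σ v)) +
      7 * ∑ x ∈ T with σ v = σ x, I.bid x (α x) (σ v) := by
  set u := σ v with hu
  have hc : 0 < I.cap u := h.cap_pos v hv
  have n1 : 0 ≤ ∑ x ∈ T with u ∈ Insert.insert x (O x), I.bid x (α x) u :=
    Finset.sum_nonneg fun x _ => I.bid_nonneg _ _ _
  have n2 : 0 ≤ ∑ x ∈ T with u = σ x, I.bid x (α x) u :=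
    Finset.sum_nonneg fun x _ => I.bid_nonneg _ _ _
  rcases h.tight v hv with ht | ht
  · have h1 : I.bid v (α v) u ≤ ∑ x ∈ T with u = σ x, I.bid x (α x) u :=
      Finset.single_le_sum (f := fun x => I.bid x (α x) u) (fun x _ => I.bid_nonneg _ _ _)
        (by simp [hv, hu])
    have h2 : α v - I.demand v * I.rate u ≤ I.bid v (α v) u := le_max_right _ _
    linarith
  · have hb : ∀ x ∈ T, u ∈ closedNbhd I.graph x → I.bid x (α x) u ≤ I.cost u / 7 := by
      intro x hx hux
      have := h.dual_le x hx u hux hc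
      exact max_le (by have := I.cost_nonneg u; linarith) (by linarith)
    have h1 : I.payment T α u ≤ (∑ x ∈ T with u ∈ Insert.insert x (O x), I.bid x (α x) u) +
        ∑ x ∈ T with u ∈ closedNbhd I.graph x ∧ x ∈ O u, I.bid x (α x) u := by
      rw [payment, ← Finset.sum_union_inter (s₁ := T.filter fun x => u ∈ Insert.insert x (O x))]
      refine le_add_of_le_of_nonneg ?_ (Finset.sum_nonneg fun x _ => I.bid_nonneg _ _ _)
      refine Finset.sum_le_sum_of_subset_of_nonneg ?_ fun x _ _ => I.bid_nonneg _ _ _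
      intro x hx
      simp only [Finset.mem_filter, Finset.mem_union, Finset.mem_insert] at hx ⊢
      rcases mem_closedNbhd.1 hx.2 with e | e
      · exact Or.inl ⟨hx.1, Or.inl e⟩
      · rcases hadj _ _ e with e | e
        · exact Or.inl ⟨hx.1, Or.inr e⟩
        · exact Or.inr ⟨hx.1, hx.2, e⟩
    have h2 : ∑ x ∈ T with u ∈ closedNbhd I.graph x ∧ x ∈ O u, I.bid x (α x) u ≤
        3 * (I.cost u / 7) := by
      refine (Finset.sum_le_card_nsmul _ _ (I.cost u / 7) ?_).trans ?_
      · intro x hx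
        simp only [Finset.mem_filter] at hx
        exact hb x hx.1 hx.2.1
      · rw [nsmul_eq_mul]
        have hcard : (T.filter fun x => u ∈ closedNbhd I.graph x ∧ x ∈ O u).card ≤ 3 :=
          (Finset.card_le_card fun x hx => (Finset.mem_filter.1 hx).2.2).trans (hO u)
        have := I.cost_nonneg u
        gcongr
        exact_mod_cast hcard
    linarith

/-- Rounding up adds less than one copy per server, and `cost_server_le` charges that copy to bids.
Exchanging the order of summation collects what each vertex is charged. -/
theorem Instance.PrimalDual.assignmentCost_le {I : Instance V} {T : Finset V} {α : V → ℝ}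
    {σ : V → V} (h : I.PrimalDual T α σ) {O : V → Finset V} (hO : ∀ v, (O v).card ≤ 3)
    (hadj : ∀ u v, I.graph.Adj u v → v ∈ O u ∨ u ∈ O v) :
    I.assignmentCost (I.serve T σ) ≤ 14 * ∑ v ∈ T, α v := by
  classical
  have h1 : ∀ u, I.cost u * I.multiplicity (I.serve T σ) u ≤
      (∑ x ∈ T with u = σ x, I.demand x * I.rate u) +
      (7 / 4 * (∑ x ∈ T with u ∈ Insert.insert x (O x), I.bid x (α x) u) +
        7 * ∑ x ∈ T with u = σ x, I.bid x (α x) u) := by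
    intro u
    have hload : ∑ x ∈ closedNbhd I.graph u, I.serve T σ x u = ∑ x ∈ T with u = σ x, I.demand x := by
      rw [Finset.sum_filter]
      have e : ∀ x, I.serve T σ x u = if x ∈ T then (if u = σ x then I.demand x else 0) else 0 := by
        intro x; unfold serve; rw [ite_and]
      simp only [e]
      rw [← Finset.sum_filter, ← Finset.sum_filter, ← Finset.sum_filter]
      refine Finset.sum_congr ?_ fun _ _ => rfl
      ext x
      simp only [Finset.mem_filter]
      refine ⟨fun hx => ⟨hx.1.2, hx.2⟩, fun hx => ⟨⟨?_, hx.1⟩, hx.2⟩⟩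
      rw [mem_closedNbhd_comm, hx.2]
      exact h.mem x hx.1
    unfold multiplicity
    rw [hload]
    have hw := I.cost_nonneg u
    by_cases hne : ∃ v ∈ T, u = σ v
    · obtain ⟨v, hv, rfl⟩ := hne
      have h2 := h.cost_server_le hO hadj hv
      have h3 : 0 ≤ (∑ x ∈ T with σ v = σ x, I.demand x) / I.cap (σ v) :=
        div_nonneg (Finset.sum_nonneg fun x _ => I.demand_nonneg x) (I.cap_nonneg _)
      calc _ ≤ I.cost (σ v) * ((∑ x ∈ T with σ v = σ x, I.demand x) / I.cap (σ v) + 1) := by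
            gcongr
            exact (Nat.ceil_lt_add_one h3).le
        _ = (∑ x ∈ T with σ v = σ x, I.demand x * I.rate (σ v)) + I.cost (σ v) := by
            rw [← Finset.sum_mul]; unfold rate; ring
        _ ≤ _ := by linarith
    -- A vertex that serves nobody has multiplicity 0, so no extra copy has to be paid for.
    · have e : T.filter (fun x => u = σ x) = ∅ := by
        apply Finset.filter_false_of_mem
        exact fun x hx hux => hne ⟨x, hx, hux⟩
      rw [e]
      have n1 : 0 ≤ ∑ x ∈ T with u ∈ Insert.insert x (O x), I.bid x (α x) u :=
        Finset.sum_nonneg fun x _ => I.bid_nonneg _ _ _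
      simp only [Finset.sum_empty, zero_div, Nat.ceil_zero, Nat.cast_zero, mul_zero, zero_add,
        add_zero]
      positivity
  -- Each `x` pays 7/4 times at most 4 bids, each at most `α x`, which is `7 α x`. The service cost
  -- at its server plus 7 times the bid there is again at most `7 α x`, since cost and bid sum to `α
  -- x`.
  have h2 : ∀ x ∈ T, (I.demand x * I.rate (σ x)) +
      (7 / 4 * (∑ u ∈ Insert.insert x (O x), I.bid x (α x) u) + 7 * I.bid x (α x) (σ x)) ≤
      14 * α x := by
    intro x hx
    have hle := h.le_dual x hx
    have hr : ∀ u, 0 ≤ I.demand x * I.rate u := fun u =>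
      mul_nonneg (I.demand_nonneg x) (I.rate_nonneg u)
    have hα : 0 ≤ α x := (hr _).trans hle
    have hb : ∀ u, I.bid x (α x) u ≤ α x := fun u => max_le hα (by have := hr u; linarith)
    have hσ : I.bid x (α x) (σ x) = α x - I.demand x * I.rate (σ x) :=
      max_eq_right (by linarith)
    have hs : ∑ u ∈ Insert.insert x (O x), I.bid x (α x) u ≤ 4 * α x := by
      refine (Finset.sum_le_card_nsmul _ _ (α x) fun u _ => hb u).trans ?_
      rw [nsmul_eq_mul]
      have hcard : (Insert.insert x (O x)).card ≤ 4 :=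
        (Finset.card_insert_le _ _).trans (by have := hO x; omega)
      gcongr
      exact_mod_cast hcard
    have := hr (σ x)
    rw [hσ]
    linarith
  calc I.assignmentCost (I.serve T σ)
      ≤ ∑ u, ((∑ x ∈ T with u = σ x, I.demand x * I.rate u) +
        (7 / 4 * (∑ x ∈ T with u ∈ Insert.insert x (O x), I.bid x (α x) u) +
        7 * ∑ x ∈ T with u = σ x, I.bid x (α x) u)) := Finset.sum_le_sum fun u _ => h1 u
    _ = ∑ x ∈ T, ((I.demand x * I.rate (σ x)) +
        (7 / 4 * (∑ u ∈ Insert.insert x (O x), I.bid x (α x) u) + 7 * I.bid x (α x) (σ x))) := by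
        simp only [Finset.sum_add_distrib, ← Finset.mul_sum]
        have s1 : ∀ F : V → V → ℝ, ∑ u, ∑ x ∈ T with u = σ x, F x u = ∑ x ∈ T, F x (σ x) := by
          intro F
          rw [Finset.sum_comm' (t' := T) (s' := fun x => {σ x}) (by simp [and_comm])]
          simp
        have s2 : ∀ F : V → V → ℝ, ∑ u, ∑ x ∈ T with u ∈ Insert.insert x (O x), F x u =
            ∑ x ∈ T, ∑ u ∈ Insert.insert x (O x), F x u := by
          intro F
          apply Finset.sum_comm'
          simp [and_comm]
        rw [s1 fun x u => I.demand x * I.rate u, s1 fun x u => I.bid x (α x) u,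
          s2 fun x u => I.bid x (α x) u]
    _ ≤ ∑ x ∈ T, 14 * α x := Finset.sum_le_sum h2
    _ = _ := by rw [Finset.mul_sum]

end PrimalDual

/-! ### Weakest preconditions for programs without loops -/

/-- A condition on the state before an instruction that ensures `Q` after it. -/
noncomputable def Instr.wp (B : ℕ) (Q : State → Prop) (s : State) : Instr → Prop
  | iconst x k => k ≤ B ∧ Q { s with ireg := Function.update s.ireg x k }
  | iadd x y z => s.ireg y + s.ireg z ≤ B ∧
      Q { s with ireg := Function.update s.ireg x (s.ireg y + s.ireg z) }
  | isub x y z => s.ireg y - s.ireg z ≤ B ∧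
      Q { s with ireg := Function.update s.ireg x (s.ireg y - s.ireg z) }
  | imul x y z => s.ireg y * s.ireg z ≤ B ∧
      Q { s with ireg := Function.update s.ireg x (s.ireg y * s.ireg z) }
  | iload x a y => s.iarr a (s.ireg y) ≤ B ∧
      Q { s with ireg := Function.update s.ireg x (s.iarr a (s.ireg y)) }
  | istore a x y =>
      let A := Function.update (s.iarr a) (s.ireg x) (s.ireg y)
      Q { s with iarr := Function.update s.iarr a A }
  | rconst x q => Q { s with rreg := Function.update s.rreg x (q : ℝ) }
  | radd x y z => Q { s with rreg := Function.update s.rreg x (s.rreg y + s.rreg z) }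
  | rsub x y z => Q { s with rreg := Function.update s.rreg x (s.rreg y - s.rreg z) }
  | rmul x y z => Q { s with rreg := Function.update s.rreg x (s.rreg y * s.rreg z) }
  | rdiv x y z => s.rreg z ≠ 0 ∧
      Q { s with rreg := Function.update s.rreg x (s.rreg y / s.rreg z) }
  | rload x a y => Q { s with rreg := Function.update s.rreg x (s.rarr a (s.ireg y)) }
  | rstore a x y =>
      let A := Function.update (s.rarr a) (s.ireg x) (s.rreg y)
      Q { s with rarr := Function.update s.rarr a A }

theorem Instr.exists_eval_of_wp {B : ℕ} {Q : State → Prop} {s : State} {i : Instr}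
    (h : i.wp B Q s) : ∃ s', i.eval B s = some s' ∧ Q s' := by
  cases i <;> simp only [wp] at h <;> simp [eval, State.setI, State.setR, h]

/-- A condition on the state before a program without loops that ensures `Q` after it. -/
noncomputable def Program.wp (B : ℕ) : Program → (State → Prop) → State → Prop
  | skip, Q, s => Q s
  | instr i, Q, s => i.wp B Q s
  | seq P R, Q, s => P.wp B (R.wp B Q) s
  | ite b P R, Q, s => (b.holds s → P.wp B Q s) ∧ (¬ b.holds s → R.wp B Q s)
  | loop _ _, _, _ => False

theorem Instr.wp_mono {B : ℕ} {Q Q' : State → Prop} (hQ : ∀ s, Q s → Q' s) {s : State} {i : Instr}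
    (h : i.wp B Q s) : i.wp B Q' s := by
  cases i <;> simp only [wp] at h ⊢ <;> first | exact hQ _ h | exact ⟨h.1, hQ _ h.2⟩

theorem Program.wp_mono {B : ℕ} {P : Program} {Q Q' : State → Prop} (hQ : ∀ s, Q s → Q' s)
    {s : State} (h : P.wp B Q s) : P.wp B Q' s := by
  induction P generalizing Q Q' s with
  | skip => exact hQ s h
  | instr i => exact Instr.wp_mono hQ h
  | seq P R ihP ihR => exact ihP (fun s hs => ihR hQ hs) h
  | ite b P R ihP ihR => exact ⟨fun hb => ihP hQ (h.1 hb), fun hb => ihR hQ (h.2 hb)⟩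
  | loop b P _ => exact h

/-- A bound for the running time of a program without loops. -/
def Program.size : Program → ℕ
  | skip => 1
  | instr _ => 1
  | seq P R => P.size + R.size
  | ite _ P R => P.size + R.size + 1
  | loop _ _ => 0

/-! ### ### Total correctness with time bounds -/

/-- The program `P` started in `s` halts in at most `t` steps in a state with property `Q`. -/
def Runs (B : ℕ) (P : Program) (s : State) (Q : State → Prop) (t : ℕ) : Prop :=
  ∃ s' t', Exec B P s s' t' ∧ t' ≤ t ∧ Q s'

theorem Runs.mono {B : ℕ} {P : Program} {s : State} {Q Q' : State → Prop} {t t' : ℕ}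
    (h : Runs B P s Q t) (hQ : ∀ s, Q s → Q' s) (ht : t ≤ t') : Runs B P s Q' t' := by
  obtain ⟨s', r, he, hr, hq⟩ := h
  exact ⟨s', r, he, hr.trans ht, hQ _ hq⟩

theorem Runs.seq {B : ℕ} {P R : Program} {s : State} {Q Q' : State → Prop} {t t' : ℕ}
    (hP : Runs B P s Q t) (hR : ∀ s, Q s → Runs B R s Q' t') :
    Runs B (.seq P R) s Q' (t + t') := by
  obtain ⟨s', r, he, hr, hq⟩ := hP
  obtain ⟨s'', r', he', hr', hq'⟩ := hR s' hq
  exact ⟨s'', r + r', .seq _ _ _ _ _ _ _ he he', add_le_add hr hr', hq'⟩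

theorem Runs.ite {B : ℕ} {b : Test} {P R : Program} {s : State} {Q : State → Prop} {t : ℕ}
    (hP : b.holds s → Runs B P s Q t) (hR : ¬ b.holds s → Runs B R s Q t) :
    Runs B (.ite b P R) s Q (t + 1) := by
  by_cases hb : b.holds s
  · obtain ⟨s', r, he, hr, hq⟩ := hP hb
    exact ⟨s', r + 1, .iteTrue _ _ _ _ _ _ hb he, by omega, hq⟩
  · obtain ⟨s', r, he, hr, hq⟩ := hR hb
    exact ⟨s', r + 1, .iteFalse _ _ _ _ _ _ hb he, by omega, hq⟩

theorem Runs.skip {B : ℕ} {s : State} {Q : State → Prop} {t : ℕ} (h : Q s) (ht : 1 ≤ t) :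
    Runs B .skip s Q t :=
  ⟨s, 1, .skip s, ht, h⟩

/-- The precondition of a loop is `False`, so the value 0 that `size` gives to loops is never used
as a time bound. -/
theorem Runs.of_wp {B : ℕ} {P : Program} {s : State} {Q : State → Prop} (h : P.wp B Q s) :
    Runs B P s Q P.size := by
  induction P generalizing s Q with
  | skip => exact .skip h le_rfl
  | instr i =>
    obtain ⟨s', he, hq⟩ := Instr.exists_eval_of_wp h
    exact ⟨s', 1, .instr _ _ _ he, le_rfl, hq⟩
  | seq P R ihP ihR => exact (ihP h).seq fun s' hs' => ihR hs'
  | ite b P R ihP ihR =>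
    exact .ite (fun hb => (ihP (h.1 hb)).mono (fun _ => id) (by omega))
      fun hb => (ihR (h.2 hb)).mono (fun _ => id) (by omega)
  | loop b P _ => exact h.elim

/-- A loop with an invariant indexed by the number of completed rounds. -/
theorem Runs.loop {B : ℕ} {b : Test} {P : Program} {N c : ℕ} (Inv : ℕ → State → Prop)
    (hb : ∀ i s, i ≤ N → Inv i s → (b.holds s ↔ i < N))
    (hP : ∀ i s, i < N → Inv i s → Runs B P s (Inv (i + 1)) c) {s : State} (hs : Inv 0 s) :
    Runs B (.loop b P) s (Inv N) (N * (c + 1) + 1) := by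
  -- Induction on the number `k` of rounds left. Each round costs its body and one test; the last
  -- summand is the failing test.
  have key : ∀ k i s, i + k = N → Inv i s → Runs B (.loop b P) s (Inv N) (k * (c + 1) + 1) := by
    intro k
    induction k with
    | zero =>
      intro i s hi h
      obtain rfl : i = N := by omega
      exact ⟨s, 1, .loopFalse _ _ _ fun hh => lt_irrefl _ ((hb i s le_rfl h).1 hh), by omega, h⟩
    | succ k ih =>
      intro i s hi h
      obtain ⟨s', r, he, hr, hq⟩ := hP i s (by omega) h
      obtain ⟨s'', r', he', hr', hq'⟩ := ih (i + 1) s' (by omega) hq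
      refine ⟨s'', r + r' + 1,
        .loopTrue _ _ _ _ _ _ _ ((hb i s (by omega) h).2 (by omega)) he he', ?_, hq'⟩
      linarith
  exact key N 0 s (by omega) hs

/-- Sequential composition of a list of programs. -/
def Program.block : List Program → Program
  | [] => .skip
  | P :: l => .seq P (block l)

/-! ### The program -/

/-- Round `i` of the first loop enters the `i`-th edge into the adjacency matrix (word array `2`),
whose entries are addressed as `u * n + v`. -/
def addEdge : Program := .block
  [.instr (.iload 5 0 2), .instr (.iload 6 1 2), .instr (.imul 7 5 0), .instr (.iadd 7 7 6),
    .instr (.istore 2 7 4), .instr (.imul 7 6 0), .instr (.iadd 7 7 5), .instr (.istore 2 7 4),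
    .instr (.iadd 2 2 4)]

/-- Makes the vertex in register `2` adjacent to itself and initializes its residual cost, which is
kept in real array `4`. -/
def addVertex : Program := .block
  [.instr (.imul 7 2 0), .instr (.iadd 7 7 2), .instr (.istore 2 7 4), .instr (.rload 2 0 2),
    .instr (.rstore 4 2 2), .instr (.iadd 2 2 4)]

/-- Runs `P` if the vertex in register `3` is a possible server for the one in register `2`, and
goes on to the next vertex. -/
def forCandidate (P : Program) : Program := .block
  [.instr (.iadd 7 9 3), .instr (.iload 7 2 7),
    .ite (.ieq 7 4) (.block [.instr (.rload 4 1 3), .ite (.rlt 0 4) P .skip]) .skip,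
    .instr (.iadd 3 3 4)]

/-- Makes the vertex in register `3` the server, at the price in real register `4`. -/
def choose : Program := .block
  [.instr (.iconst 8 1), .instr (.iadd 10 3 11), .instr (.radd 3 4 0)]

/-- Computes the price at which the vertex in register `3` becomes a server, and compares it with
the best price so far, in real register `3`. -/
def scan : Program := .block
  [.instr (.rload 5 0 3), .instr (.rdiv 4 5 4), .instr (.rmul 4 2 4), .instr (.rmul 5 5 1),
    .instr (.rload 6 4 3),
    .ite (.rlt 6 5) (.instr (.radd 4 4 6)) (.instr (.radd 4 4 5)),
    .ite (.ieq 8 4) (.ite (.rlt 4 3) choose .skip) choose]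

/-- Subtracts the contribution from the residual cost of the vertex in register `3`. -/
def pay : Program := .block
  [.instr (.rload 5 0 3), .instr (.rdiv 4 5 4), .instr (.rmul 4 2 4), .instr (.rsub 4 3 4),
    .ite (.rlt 0 4)
      (.block [.instr (.rload 6 4 3), .instr (.rsub 6 6 4), .instr (.rstore 4 3 6)]) .skip]

/-- Serves the vertex in register `2`. -/
def serveVertex : Program :=
  .seq (.instr (.rload 2 2 2)) <| .seq
    (.ite (.rlt 0 2)
      (.seq (.block [.instr (.imul 9 2 0), .instr (.iconst 8 0), .instr (.iconst 3 0)]) <|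
        .seq (.loop (.ilt 3 0) (forCandidate scan)) <|
        .ite (.ieq 8 4)
          (.seq (.block [.instr (.iadd 7 9 10), .instr (.rstore 3 7 2), .instr (.iconst 3 0)])
            (.loop (.ilt 3 0) (forCandidate pay)))
          .skip)
      .skip)
    (.instr (.iadd 2 2 4))

/-- The whole program. -/
def primalDualProgram : Program :=
  .seq (.block [.instr (.iconst 4 1), .instr (.rconst 1 (1 / 7))]) <|
    .seq (.loop (.ilt 2 1) addEdge) <|
    .seq (.instr (.iconst 2 0)) <|
    .seq (.loop (.ilt 2 0) addVertex) <|
    .seq (.instr (.iconst 2 0)) <|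
    .loop (.ilt 2 0) serveVertex

/-! ### Correctness of the program -/

section Correctness

variable {n : ℕ}

/-- The registers and arrays that no part of the program changes after the first two steps. -/
structure Env (I : Instance (Fin n)) (s : State) : Prop where
  size : s.ireg 0 = n
  one : s.ireg 4 = 1
  zero : s.ireg 11 = 0
  rzero : s.rreg 0 = 0
  seventh : s.rreg 1 = 7⁻¹
  cost : ∀ u : Fin n, s.rarr 0 u = I.cost u
  cap : ∀ u : Fin n, s.rarr 1 u = I.cap u
  demand : ∀ u : Fin n, s.rarr 2 u = I.demand u

theorem index_lt (u v : Fin n) : (u : ℕ) * n + v < n * n := by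
  have h1 := u.2
  have h2 := v.2
  nlinarith

theorem index_inj {u v u' v' : Fin n} : (u : ℕ) * n + v = u' * n + v' ↔ u = u' ∧ v = v' := by
  refine ⟨fun h => ?_, by rintro ⟨rfl, rfl⟩; rfl⟩
  have hn : 0 < n := u.pos
  have h1 : ((u : ℕ) * n + v) / n = u := by
    rw [mul_comm, Nat.mul_add_div hn, Nat.div_eq_of_lt v.2, add_zero]
  have h2 : ((u' : ℕ) * n + v') / n = u' := by
    rw [mul_comm, Nat.mul_add_div hn, Nat.div_eq_of_lt v'.2, add_zero]
  have h3 : (u : ℕ) = u' := by rw [← h1, ← h2, h]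
  rw [h3] at h
  exact ⟨Fin.ext h3, Fin.ext (by omega)⟩

/-! ### ### Building the adjacency matrix -/

open Classical in
/-- The invariant of the first loop. -/
structure EdgeInv (I : Instance (Fin n)) (L : List (Fin n × Fin n)) (i : ℕ) (s : State) :
    Prop where
  env : Env I s
  length : s.ireg 1 = L.length
  counter : s.ireg 2 = i
  fst : ∀ (j : ℕ) (hj : j < L.length), s.iarr 0 j = L[j].1
  snd : ∀ (j : ℕ) (hj : j < L.length), s.iarr 1 j = L[j].2
  adj : ∀ u v : Fin n,
    s.iarr 2 (u * n + v) = if ∃ e ∈ L.take i, s(e.1, e.2) = s(u, v) then 1 else 0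
  out : s.rarr 3 = 0

theorem addEdge_wp {I : Instance (Fin n)} {L : List (Fin n × Fin n)} {i B : ℕ} {s : State}
    (hB : n * n + n + 1 ≤ B) (hLB : L.length ≤ B) (h : EdgeInv I L i s) (hi : i < L.length) :
    addEdge.wp B (EdgeInv I L (i + 1)) s := by
  obtain ⟨⟨h1, h2, h3, h4, h5, h6, h7, h8⟩, h9, h10, h11, h12, h13, h14⟩ := h
  have e1 := h11 i hi
  have e2 := h12 i hi
  have h15 : ∀ u v : Fin n, (∃ e ∈ L.take (i + 1), s(e.1, e.2) = s(u, v)) ↔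
      (∃ e ∈ L.take i, s(e.1, e.2) = s(u, v)) ∨ s(L[i].1, L[i].2) = s(u, v) := by
    intro u v
    rw [← List.take_concat_get' L i hi]
    simp only [List.mem_append, List.mem_singleton, or_and_right, exists_or, exists_eq_left]
  generalize L[i].1 = a at *
  generalize L[i].2 = b at *
  have i1 := index_lt a b
  have i2 := index_lt b a
  have b0 : (a : ℕ) ≤ B := by nlinarith [a.2]
  have b1 : (b : ℕ) ≤ B := by nlinarith [b.2]
  have b2 : (a : ℕ) * n ≤ B := by omega
  have b3 : (a : ℕ) * n + b ≤ B := by omega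
  have b4 : (b : ℕ) * n ≤ B := by omega
  have b5 : (b : ℕ) * n + a ≤ B := by omega
  have b6 : i + 1 ≤ B := by omega
  simp only [addEdge, Program.block, Program.wp, Instr.wp, Function.update_apply, h1, h2, h10, e1,
    e2, b0, b1, b2, b3, b4, b5, b6, true_and, reduceIte, Nat.reduceEqDiff]
  refine ⟨⟨by simpa, by simpa, by simpa, by simpa, by simpa, by simpa, by simpa, by simpa⟩,
    by simpa, by simp, by simpa, by simpa, fun u v => ?_, by simpa⟩
  simp only [Function.update_apply, reduceIte, index_inj, h13, if_congr (h15 u v) rfl rfl]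
  -- An unordered pair fits in two ways, matching the two entries written in this round.
  have h16 : s(a, b) = s(u, v) ↔ a = u ∧ b = v ∨ a = v ∧ b = u := Sym2.eq_iff
  by_cases h17 : ∃ e ∈ L.take i, s(e.1, e.2) = s(u, v)
  · simp only [h17, if_true, true_or, ite_self]
  · simp only [h17, false_or, if_false, if_congr h16 rfl rfl]
    split_ifs <;> first | rfl | grind

open Classical in
/-- The invariant of the second loop. -/
structure VertexInv (I : Instance (Fin n)) (i : ℕ) (s : State) : Prop where
  env : Env I s
  counter : s.ireg 2 = i
  adj : ∀ u v : Fin n,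
    s.iarr 2 (u * n + v) = if I.graph.Adj u v ∨ u = v ∧ (u : ℕ) < i then 1 else 0
  slack : ∀ u : Fin n, (u : ℕ) < i → s.rarr 4 u = I.cost u
  out : s.rarr 3 = 0

theorem addVertex_wp {I : Instance (Fin n)} {i B : ℕ} {s : State}
    (hB : n * n + n + 1 ≤ B) (h : VertexInv I i s) (hi : i < n) :
    addVertex.wp B (VertexInv I (i + 1)) s := by
  obtain ⟨⟨h1, h2, h3, h4, h5, h6, h7, h8⟩, h10, h11, h12, h13⟩ := h
  have i1 := index_lt (⟨i, hi⟩ : Fin n) ⟨i, hi⟩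
  simp only at i1
  have b1 : i * n ≤ B := by omega
  have b2 : i * n + i ≤ B := by omega
  have b3 : i + 1 ≤ B := by omega
  simp only [addVertex, Program.block, Program.wp, Instr.wp, Function.update_apply, h1, h2, h10,
    b1, b2, b3, true_and, reduceIte, Nat.reduceEqDiff]
  refine ⟨⟨by simpa, by simpa, by simpa, by simpa, by simpa, by simpa, by simpa, by simpa⟩,
    by simp, fun u v => ?_, fun u hu => ?_, by simpa⟩
  · have h14 : (u : ℕ) * n + v = i * n + i ↔ u = i ∧ (v : ℕ) = i := by
      rw [← Fin.val_mk hi, index_inj, Fin.ext_iff, Fin.ext_iff]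
    have h15 : (u : ℕ) < i + 1 ↔ (u : ℕ) < i ∨ (u : ℕ) = i := by omega
    simp only [Function.update_apply, reduceIte, h14, h11, Fin.ext_iff, h15]
    split_ifs <;> first | rfl | omega | grind
  · simp only [Function.update_apply, reduceIte]
    split_ifs with hui
    · exact hui ▸ h6 u
    · exact h12 u (by omega)

/-! ### ### Loops over possible servers -/

open Classical in
/-- The fixed registers and arrays after the adjacency matrix has been computed. -/
structure Ready (I : Instance (Fin n)) (s : State) : Prop extends Env I s where
  adj : ∀ u v : Fin n, s.iarr 2 (u * n + v) = if v ∈ closedNbhd I.graph u then 1 else 0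

/-- The fixed registers while the vertex `v` looks at the vertex `j`. -/
structure Round (I : Instance (Fin n)) (v : Fin n) (j : ℕ) (s : State) : Prop extends
    Ready I s where
  vertex : s.ireg 2 = v
  row : s.ireg 9 = v * n
  rdemand : s.rreg 2 = I.demand v
  counter : s.ireg 3 = j

/-- `u` can serve `v`. -/
def Instance.Candidate (I : Instance (Fin n)) (v u : Fin n) : Prop :=
  u ∈ closedNbhd I.graph v ∧ 0 < I.cap u

/-- A condition on the variable registers and arrays in the loops over possible servers. -/
def Holds (C : ℕ → ℕ → ℝ → (ℕ → ℝ) → (ℕ → ℝ) → Prop) (s : State) : Prop :=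
  C (s.ireg 8) (s.ireg 10) (s.rreg 3) (s.rarr 4) (s.rarr 3)

/-- Common frame for `scan` and `pay`. `Holds` depends on none of the registers used for the
membership test, the capacity test and the counter, so only the effect of `P` on a possible server
remains to be checked. The capacity test also makes divisions by the capacity safe. -/
theorem forCandidate_wp {I : Instance (Fin n)} {v : Fin n} {j B : ℕ} {s : State} {P : Program}
    {C C' : ℕ → ℕ → ℝ → (ℕ → ℝ) → (ℕ → ℝ) → Prop}
    (hB : n * n + n + 1 ≤ B) (h : Round I v j s) (hC : Holds C s) (hj : j < n)
    (hP : ∀ s, I.Candidate v ⟨j, hj⟩ → Round I v j s → Holds C s → s.rreg 4 = I.cap ⟨j, hj⟩ →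
      P.wp B (fun s' => Round I v j s' ∧ Holds C' s') s)
    (hN : ¬ I.Candidate v ⟨j, hj⟩ → ∀ s, Holds C s → Holds C' s) :
    (forCandidate P).wp B (fun s => Round I v (j + 1) s ∧ Holds C' s) s := by
  obtain ⟨⟨⟨h1, h2, h3, h4, h5, h6, h7, h8⟩, h9⟩, h10, h11, h12, h13⟩ := h
  have i1 := index_lt v (⟨j, hj⟩ : Fin n)
  have a1 := h9 v ⟨j, hj⟩
  have c1 := h7 ⟨j, hj⟩
  simp only at i1 a1 c1
  have b1 : v * n + j ≤ B := by omega
  have b2 : ∀ b : ℕ, b ≤ 1 → b ≤ B := by omega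
  have b3 : j + 1 ≤ B := by omega
  have step : ∀ s, Round I v j s ∧ Holds C' s →
      Program.wp B (.block [.instr (.iadd 3 3 4)])
        (fun s => Round I v (j + 1) s ∧ Holds C' s) s := by
    rintro s ⟨⟨⟨⟨h1, h2, h3, h4, h5, h6, h7, h8⟩, h9⟩, h10, h11, h12, h13⟩, h14⟩
    simp only [Program.block, Program.wp, Instr.wp, h2, h13, b3, true_and]
    refine ⟨⟨⟨⟨by simpa, by simpa, by simpa, by simpa, by simpa, by simpa, by simpa, by simpa⟩,
      by simpa⟩, by simpa, by simpa, by simpa, by simp⟩, by simpa [Holds] using h14⟩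
  rw [forCandidate, Program.block, Program.block, Program.block]
  generalize Program.block [.instr (.iadd 3 3 4)] = R at step ⊢
  simp only [Program.wp, Instr.wp, Function.update_apply, reduceIte, h11, h13,
    b1, true_and, a1]
  refine ⟨b2 _ (by split_ifs <;> simp), fun hb => ?_, fun hb => ?_⟩
  · simp only [Program.block, Program.wp, Instr.wp, Test.holds, Function.update_apply, reduceIte,
      Nat.reduceEqDiff, h13, h4, c1, h2] at hb ⊢
    have hb' : (⟨j, hj⟩ : Fin n) ∈ closedNbhd I.graph v := by
      by_contra hcon
      simp [hcon] at hb
    refine ⟨fun hc => ?_, fun hc => ?_⟩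
    · refine Program.wp_mono step (hP _ ⟨hb', hc⟩ ?_ ?_ ?_)
      · exact ⟨⟨⟨by simpa, by simpa, by simpa, by simpa, by simpa, by simpa, by simpa, by simpa⟩,
          by simpa⟩, by simpa, by simpa, by simpa, by simpa⟩
      · simpa [Holds] using hC
      · simp
    · refine step _ ⟨?_, hN (fun h => hc h.2) _ ?_⟩
      · exact ⟨⟨⟨by simpa, by simpa, by simpa, by simpa, by simpa, by simpa, by simpa, by simpa⟩,
          by simpa⟩, by simpa, by simpa, by simpa, by simpa⟩
      · simpa [Holds] using hC
  · simp only [Test.holds, Function.update_apply, reduceIte, Nat.reduceEqDiff, h2] at hb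
    refine step _ ⟨?_, hN (fun h => hb (by simp [h.1])) _ ?_⟩
    · exact ⟨⟨⟨by simpa, by simpa, by simpa, by simpa, by simpa, by simpa, by simpa, by simpa⟩,
        by simpa⟩, by simpa, by simpa, by simpa, by simpa⟩
    · simpa [Holds] using hC

/-- The price at which `u` with residual cost `r` can become the server of `v`. -/
noncomputable def Instance.price (I : Instance (Fin n)) (v u : Fin n) (r : ℝ) : ℝ :=
  I.demand v * I.rate u + min r (I.cost u / 7)

/-- The best server of `v` among the first `j` vertices has been found. -/
def BestServer (I : Instance (Fin n)) (v : Fin n) (S F : ℕ → ℝ) (j f x : ℕ) (p : ℝ)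
    (A A' : ℕ → ℝ) : Prop :=
  A = S ∧ A' = F ∧ ((f = 0 ∧ ∀ u : Fin n, (u : ℕ) < j → ¬ I.Candidate v u) ∨
    (f = 1 ∧ (∃ u : Fin n, x = u ∧ I.Candidate v u ∧ p = I.price v u (S u)) ∧
      ∀ u : Fin n, (u : ℕ) < j → I.Candidate v u → p ≤ I.price v u (S u)))

/-- One update of a running minimum. The flag in register `8` replaces an infinite initial price:
the first candidate is always taken, later ones only on strict improvement. -/
theorem improve_wp {I : Instance (Fin n)} {v : Fin n} {S F : ℕ → ℝ} {j B : ℕ} (hj : j < n)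
    (hB : n * n + n + 1 ≤ B) {s : State} (hc : I.Candidate v ⟨j, hj⟩) (h : Round I v j s)
    (hb : Holds (BestServer I v S F j) s) (hp : s.rreg 4 = I.price v ⟨j, hj⟩ (S j)) :
    (Program.ite (.ieq 8 4) (.ite (.rlt 4 3) choose .skip) choose).wp B
      (fun s' => Round I v j s' ∧ Holds (BestServer I v S F (j + 1)) s') s := by
  obtain ⟨⟨⟨h1, h2, h3, h4, h5, h6, h7, h8⟩, h9⟩, h10, h11, h12, h13⟩ := id h
  obtain ⟨hS, hF, hb⟩ := hb
  have b1 : 1 ≤ B := by omega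
  have b2 : j ≤ B := by omega
  have ext : ∀ {p : ℝ} {u : Fin n}, (u : ℕ) < j + 1 → ¬ (u : ℕ) < j →
      p ≤ I.price v ⟨j, hj⟩ (S j) → p ≤ I.price v u (S u) := by
    intro p u hu hu' hp
    obtain rfl : u = ⟨j, hj⟩ := Fin.ext (by simp only; omega)
    exact hp
  have hchoose : (∀ u : Fin n, (u : ℕ) < j → I.Candidate v u → s.rreg 4 ≤ I.price v u (S u)) →
      choose.wp B (fun s' => Round I v j s' ∧ Holds (BestServer I v S F (j + 1)) s') s := by
    intro hmin
    simp only [choose, Program.block, Program.wp, Instr.wp, Function.update_apply, reduceIte,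
      Nat.reduceEqDiff, b1, true_and, h3, h13, add_zero, b2, h4]
    refine ⟨⟨⟨⟨by simpa, by simpa, by simpa, by simpa, by simpa, by simpa, by simpa, by simpa⟩,
      by simpa⟩, by simpa, by simpa, by simpa, by simpa⟩, hS, hF, Or.inr ⟨by simp, ?_, ?_⟩⟩
    · exact ⟨⟨j, hj⟩, by simp, hc, by simpa using hp⟩
    · intro u hu hcu
      simp only [Function.update_apply, reduceIte]
      by_cases hu' : (u : ℕ) < j
      · exact hmin u hu' hcu
      · exact ext hu hu' hp.le
  simp only [Program.wp, Test.holds, h2]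
  refine ⟨fun hf => ⟨fun hlt => hchoose ?_, fun hlt => ⟨h, hS, hF, Or.inr ⟨hf, ?_⟩⟩⟩,
    fun hf => hchoose ?_⟩
  · rcases hb with hb | hb
    · exact absurd (hf.symm.trans hb.1) one_ne_zero
    · exact fun u hu hcu => hlt.le.trans (hb.2.2 u hu hcu)
  · rcases hb with hb | hb
    · exact absurd (hf.symm.trans hb.1) one_ne_zero
    · refine ⟨hb.2.1, fun u hu hcu => ?_⟩
      by_cases hu' : (u : ℕ) < j
      · exact hb.2.2 u hu' hcu
      · exact ext hu hu' (hp ▸ not_lt.1 hlt)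
  · rcases hb with hb | hb
    · exact fun u hu hcu => absurd hcu (hb.2 u hu)
    · exact absurd hb.1 hf

theorem scan_wp {I : Instance (Fin n)} {v : Fin n} {S F : ℕ → ℝ} {j B : ℕ} (hj : j < n)
    (hB : n * n + n + 1 ≤ B) {s : State} (hc : I.Candidate v ⟨j, hj⟩) (h : Round I v j s)
    (hb : Holds (BestServer I v S F j) s) (hcap : s.rreg 4 = I.cap ⟨j, hj⟩) :
    scan.wp B (fun s' => Round I v j s' ∧ Holds (BestServer I v S F (j + 1)) s') s := by
  obtain ⟨⟨⟨h1, h2, h3, h4, h5, h6, h7, h8⟩, h9⟩, h10, h11, h12, h13⟩ := h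
  have hS : s.rarr 4 = S := hb.1
  have c1 := h6 ⟨j, hj⟩
  have c2 : I.cap ⟨j, hj⟩ ≠ 0 := hc.2.ne'
  simp only at c1
  have himp : ∀ s, I.Candidate v ⟨j, hj⟩ ∧ Round I v j s ∧ Holds (BestServer I v S F j) s ∧
      s.rreg 4 = I.price v ⟨j, hj⟩ (S j) →
      Program.wp B (.block [Program.ite (.ieq 8 4) (.ite (.rlt 4 3) choose .skip) choose])
      (fun s' => Round I v j s' ∧ Holds (BestServer I v S F (j + 1)) s') s :=
    fun s hs => improve_wp hj hB hs.1 hs.2.1 hs.2.2.1 hs.2.2.2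
  rw [scan]
  iterate 6 rw [Program.block]
  simp only [Program.wp, Instr.wp, Test.holds, Function.update_apply, reduceIte, Nat.reduceEqDiff,
    h13, hcap, c1, ne_eq, c2, not_false_eq_true, true_and, h12, h5, hS]
  refine ⟨fun hlt => himp _ ⟨hc, ?_, ?_, ?_⟩, fun hlt => himp _ ⟨hc, ?_, ?_, ?_⟩⟩
  · exact ⟨⟨⟨by simpa, by simpa, by simpa, by simpa, by simpa, by simpa, by simpa, by simpa⟩,
      by simpa⟩, by simpa, by simpa, by simpa, by simpa⟩
  · simpa [Holds] using hb
  · simp only [Function.update_apply, reduceIte, Instance.price, Instance.rate]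
    rw [min_eq_left (by rw [div_eq_mul_inv]; exact hlt.le)]
  · exact ⟨⟨⟨by simpa, by simpa, by simpa, by simpa, by simpa, by simpa, by simpa, by simpa⟩,
      by simpa⟩, by simpa, by simpa, by simpa, by simpa⟩
  · simpa [Holds] using hb
  · simp only [Function.update_apply, reduceIte, Instance.price, Instance.rate]
    rw [min_eq_right (by rw [div_eq_mul_inv]; exact not_lt.1 hlt), div_eq_mul_inv (I.cost _) 7]

open Classical in
/-- The contributions of `v` to the first `j` vertices have been subtracted. -/
def Paid (I : Instance (Fin n)) (v : Fin n) (a : ℝ) (S F : ℕ → ℝ) (j _f _x : ℕ) (p : ℝ)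
    (A A' : ℕ → ℝ) : Prop :=
  p = a ∧ A' = F ∧ ∀ u : Fin n,
    A u = S u - if (u : ℕ) < j ∧ I.Candidate v u then I.bid v a u else 0

open Classical in
theorem pay_wp {I : Instance (Fin n)} {v : Fin n} {a : ℝ} {S F : ℕ → ℝ} {j B : ℕ} (hj : j < n)
    {s : State} (hc : I.Candidate v ⟨j, hj⟩) (h : Round I v j s)
    (hb : Holds (Paid I v a S F j) s) (hcap : s.rreg 4 = I.cap ⟨j, hj⟩) :
    pay.wp B (fun s' => Round I v j s' ∧ Holds (Paid I v a S F (j + 1)) s') s := by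
  obtain ⟨⟨⟨h1, h2, h3, h4, h5, h6, h7, h8⟩, h9⟩, h10, h11, h12, h13⟩ := h
  obtain ⟨hp, hF, hA⟩ := hb
  have c1 := h6 ⟨j, hj⟩
  have c2 : I.cap ⟨j, hj⟩ ≠ 0 := hc.2.ne'
  simp only at c1
  have hj1 : ∀ u : Fin n, ((u : ℕ) < j + 1 ∧ I.Candidate v u ↔
      ((u : ℕ) < j ∧ I.Candidate v u) ∨ u = ⟨j, hj⟩) := by
    intro u
    constructor
    · rintro ⟨hu, hcu⟩
      by_cases hu' : (u : ℕ) < j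
      · exact Or.inl ⟨hu', hcu⟩
      · exact Or.inr (Fin.ext (by simp only; omega))
    · rintro (hu | rfl)
      · exact ⟨by omega, hu.2⟩
      · exact ⟨by simp, hc⟩
  have hAj : s.rarr 4 j = S j := by
    have := hA ⟨j, hj⟩
    simpa using this
  simp only [pay, Program.block, Program.wp, Instr.wp, Test.holds, Function.update_apply,
    reduceIte, Nat.reduceEqDiff, h13, hcap, c1, ne_eq, c2, not_false_eq_true, true_and, h12, hp, h4,
    hAj]
  refine ⟨fun hlt => ⟨?_, ?_, ?_, fun u => ?_⟩, fun hlt => ⟨?_, ?_, ?_, fun u => ?_⟩⟩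
  · exact ⟨⟨⟨by simpa, by simpa, by simpa, by simpa, by simpa, by simpa, by simpa, by simpa⟩,
      by simpa⟩, by simpa, by simpa, by simpa, by simpa⟩
  · simpa using hp
  · simpa using hF
  · simp only [Function.update_apply, reduceIte]
    by_cases hu : u = ⟨j, hj⟩
    · subst hu
      rw [if_pos rfl, if_pos ⟨by simp, hc⟩, Instance.bid, Instance.rate, max_eq_right hlt.le]
    · have hu' : (u : ℕ) ≠ j := fun h => hu (Fin.ext h)
      rw [if_neg hu', hA u, if_congr (hj1 u) rfl rfl]
      simp [hu]
  · exact ⟨⟨⟨by simpa, by simpa, by simpa, by simpa, by simpa, by simpa, by simpa, by simpa⟩,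
      by simpa⟩, by simpa, by simpa, by simpa, by simpa⟩
  · simpa using hp
  · simpa using hF
  · by_cases hu : u = ⟨j, hj⟩
    · subst hu
      -- When the excess is not positive the bid is 0, so leaving the residual cost untouched is
      -- correct.
      rw [if_pos ⟨by simp, hc⟩, Instance.bid, Instance.rate, max_eq_left (not_lt.1 hlt), sub_zero]
      exact hAj
    · refine (hA u).trans ?_
      rw [if_congr (hj1 u) rfl rfl]
      simp [hu]

/-! ### ### The main loop -/

open Classical in
/-- The vertices among the first `k` whose demand is positive and can be served. -/
noncomputable def Instance.served (I : Instance (Fin n)) (k : ℕ) : Finset (Fin n) :=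
  Finset.univ.filter fun v => (v : ℕ) < k ∧ 0 < I.demand v ∧ ∃ u, I.Candidate v u

theorem Instance.served_succ_of_not (I : Instance (Fin n)) {v : Fin n}
    (h : ¬ (0 < I.demand v ∧ ∃ u, I.Candidate v u)) : I.served (v + 1) = I.served v := by
  ext x
  simp only [served, Finset.mem_filter, Finset.mem_univ, true_and]
  refine and_congr_left fun hx => ?_
  have : x ≠ v := by rintro rfl; exact h hx
  have := Fin.val_ne_of_ne this
  omega

theorem Instance.served_succ (I : Instance (Fin n)) {v : Fin n}
    (h : 0 < I.demand v ∧ ∃ u, I.Candidate v u) : I.served (v + 1) = insert v (I.served v) := by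
  ext x
  simp only [served, Finset.mem_filter, Finset.mem_univ, true_and, Finset.mem_insert]
  by_cases hx : x = v
  · subst hx
    simp [h]
  · have := Fin.val_ne_of_ne hx
    simp only [hx, false_or]
    refine and_congr_left fun _ => ?_
    omega

theorem Instance.notMem_served (I : Instance (Fin n)) (v : Fin n) : v ∉ I.served v := by
  simp [served]

/-- A vertex outside `T` has a zero row, so writing a single matrix entry records its new server. -/
theorem Instance.serve_insert (I : Instance (Fin n)) {T : Finset (Fin n)} {v : Fin n} (hv : v ∉ T)
    (σ : Fin n → Fin n) (u x y : Fin n) :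
    I.serve (insert v T) (Function.update σ v u) x y =
      if x = v ∧ y = u then I.demand v else I.serve T σ x y := by
  unfold serve
  by_cases hx : x = v
  · subst hx
    simp [hv]
  · simp [hx]

/-- The real arrays `4` and `3` hold residual costs and a demand assignment that come from a
primal-dual solution on the first `k` vertices. -/
def Solves (I : Instance (Fin n)) (k : ℕ) (A A' : ℕ → ℝ) : Prop :=
  ∃ α σ, I.PrimalDual (I.served k) α σ ∧
    (∀ u : Fin n, 0 < I.cap u → A u = I.cost u - I.payment (I.served k) α u) ∧
    ∀ v u : Fin n, A' (v * n + u) = I.serve (I.served k) σ v u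

theorem Solves.succ_of_not {I : Instance (Fin n)} {v : Fin n} {A A' : ℕ → ℝ}
    (h : Solves I v A A') (hv : ¬ (0 < I.demand v ∧ ∃ u, I.Candidate v u)) :
    Solves I (v + 1) A A' := by
  rwa [Solves, I.served_succ_of_not hv]

open Classical in
-- One successful round of the main loop is one application of `PrimalDual.insert`. Residual costs
-- are compared only at positive capacity because the program never charges other vertices, whereas
-- `payment` is defined for them too.
theorem Solves.succ {I : Instance (Fin n)} {v u₀ : Fin n} {A A' S F : ℕ → ℝ} {a : ℝ}
    (h : Solves I v S F) (hd : 0 < I.demand v) (hu₀ : I.Candidate v u₀)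
    (ha : a = I.price v u₀ (S u₀)) (hmin : ∀ u, I.Candidate v u → a ≤ I.price v u (S u))
    (hA : ∀ u : Fin n, A u = S u - if I.Candidate v u then I.bid v a u else 0)
    (hA' : A' = Function.update F (v * n + u₀) (I.demand v)) :
    Solves I (v + 1) A A' := by
  obtain ⟨α, σ, hpd, hS, hF⟩ := h
  have hv := I.notMem_served v
  refine ⟨Function.update α v a, Function.update σ v u₀, ?_⟩
  rw [I.served_succ ⟨hd, u₀, hu₀⟩]
  refine ⟨hpd.insert hv hd hu₀.1 hu₀.2 ?_ fun u hu hc => ?_, fun u hc => ?_, fun x y => ?_⟩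
  · rw [ha, Instance.price, hS u₀ hu₀.2]
  · rw [← hS u hc]
    exact hmin u ⟨hu, hc⟩
  · rw [I.payment_insert α hv, hA, hS u hc]
    simp only [Instance.Candidate, hc, and_true]
    ring
  · rw [I.serve_insert hv, hA', Function.update_apply, ← hF x y]
    simp only [index_inj]

/-- The invariant of the main loop. -/
structure MainInv (I : Instance (Fin n)) (k : ℕ) (s : State) : Prop where
  ready : Ready I s
  counter : s.ireg 2 = k
  solves : Solves I k (s.rarr 4) (s.rarr 3)

theorem forCandidate_loop {I : Instance (Fin n)} {v : Fin n} {B c : ℕ} {P : Program}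
    {C : ℕ → ℕ → ℕ → ℝ → (ℕ → ℝ) → (ℕ → ℝ) → Prop}
    (hB : n * n + n + 1 ≤ B) (hc : (forCandidate P).size ≤ c)
    (hP : ∀ (j : ℕ) (hj : j < n) s, I.Candidate v ⟨j, hj⟩ → Round I v j s → Holds (C j) s →
      s.rreg 4 = I.cap ⟨j, hj⟩ → P.wp B (fun s' => Round I v j s' ∧ Holds (C (j + 1)) s') s)
    (hN : ∀ (j : ℕ) (hj : j < n), ¬ I.Candidate v ⟨j, hj⟩ → ∀ s, Holds (C j) s →
      Holds (C (j + 1)) s) {s : State} (h : Round I v 0 s) (hC : Holds (C 0) s) :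
    Runs B (.loop (.ilt 3 0) (forCandidate P)) s (fun s => Round I v n s ∧ Holds (C n) s)
      (n * (c + 1) + 1) := by
  refine Runs.loop (fun j s => Round I v j s ∧ Holds (C j) s) (fun j s _ hs => ?_)
    (fun j s hj hs => ?_) ⟨h, hC⟩
  · rw [Test.holds, hs.1.counter, hs.1.size]
  · exact (Runs.of_wp (forCandidate_wp hB hs.1 hs.2 hj (fun s => hP j hj s)
      (hN j hj))).mono (fun _ => id) hc

/-- Two passes over all vertices, one to find the cheapest server and one to subtract the bids, each
with a body of constant length. -/
theorem serveVertex_runs {I : Instance (Fin n)} {v : Fin n} {B : ℕ} {s : State}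
    (hB : n * n + n + 1 ≤ B) (h : MainInv I v s) :
    Runs B serveVertex s (MainInv I (v + 1)) (100 * (n + 1)) := by
  classical
  have b1 : v * n ≤ B := by have := index_lt v v; omega
  have b2 : (v : ℕ) + 1 ≤ B := by have := v.2; omega
  have hlast : ∀ {j : ℕ} (hj : j < n) {u : Fin n}, (u : ℕ) < j + 1 → ¬ (u : ℕ) < j →
      u = ⟨j, hj⟩ := by
    intro j hj u hu hu'
    exact Fin.ext (by simp only; omega)
  have hload : Program.wp B (.instr (.rload 2 2 2))
      (fun s => MainInv I v s ∧ s.rreg 2 = I.demand v) s := by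
    obtain ⟨⟨⟨h1, h2, h3, h4, h5, h6, h7, h8⟩, h9⟩, h10, h11⟩ := h
    simp only [Program.wp, Instr.wp, h10]
    exact ⟨⟨⟨⟨by simpa, by simpa, by simpa, by simpa, by simpa, by simpa, by simpa, by simpa⟩,
      by simpa⟩, by simpa, by simpa⟩, by simp [h8]⟩
  refine Runs.mono (Q := MainInv I (v + 1)) ((Runs.of_wp hload).seq (t' := 99 * (n + 1)) ?_)
    (fun _ => id) (by simp only [Program.size]; omega)
  rintro s ⟨h, hd⟩
  -- The vertex `v` has been treated but the counter has not yet moved on.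
  let Mid : State → Prop := fun s =>
    Ready I s ∧ s.ireg 2 = v ∧ Solves I (v + 1) (s.rarr 4) (s.rarr 3)
  refine Runs.mono (Q := MainInv I (v + 1)) (Runs.seq (Q := Mid) (t := 96 * (n + 1) + 1 + 1)
    (t' := 1) (Runs.ite (fun hpos => ?_) fun hpos => ?_) ?_) (fun _ => id) (by omega)
  · rw [Test.holds, h.ready.rzero, hd] at hpos
    have hsolves := h.solves
    set S := s.rarr 4 with hS
    set F := s.rarr 3 with hF
    have hstart : Program.wp B
        (.block [.instr (.imul 9 2 0), .instr (.iconst 8 0), .instr (.iconst 3 0)])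
        (fun s => Round I v 0 s ∧ Holds (BestServer I v S F 0) s) s := by
      obtain ⟨⟨⟨h1, h2, h3, h4, h5, h6, h7, h8⟩, h9⟩, h10, h11⟩ := h
      simp only [Program.block, Program.wp, Instr.wp, h10, h1, b1, zero_le, true_and]
      exact ⟨⟨⟨⟨by simpa, by simpa, by simpa, by simpa, by simpa, by simpa, by simpa, by simpa⟩,
        by simpa⟩, by simpa, by simp, by simpa, by simp⟩, rfl, rfl, Or.inl (by simp)⟩
    refine Runs.mono (Q := Mid) ((Runs.of_wp hstart).seq (t' := 92 * (n + 1)) fun s hs => ?_)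
      (fun _ => id) (by simp only [Program.size, Program.block]; omega)
    refine Runs.mono (Q := Mid) ((forCandidate_loop (c := 40) (C := BestServer I v S F) hB
      (by decide) (fun j hj s hc hr hC hcap => scan_wp hj hB hc hr hC hcap) ?_ hs.1 hs.2).seq
      (t' := 50 * n + 20 + 1) ?_) (fun _ => id) (by omega)
    · rintro j hj hc s ⟨h1, h2, h3⟩
      refine ⟨h1, h2, h3.imp (fun h => ⟨h.1, fun u hu hcu => ?_⟩)
        fun h => ⟨h.1, h.2.1, fun u hu hcu => ?_⟩⟩
      · by_cases hu' : (u : ℕ) < j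
        · exact h.2 u hu' hcu
        · exact hc (hlast hj hu hu' ▸ hcu)
      · by_cases hu' : (u : ℕ) < j
        · exact h.2.2 u hu' hcu
        · exact absurd (hlast hj hu hu' ▸ hcu) hc
    · rintro s ⟨hr, hs4, hs3, hb⟩
      refine Runs.ite (fun hf => ?_) fun hf => ?_
      · rw [Test.holds, hr.one] at hf
        obtain ⟨-, ⟨u₀, hx, hc, hp⟩, hmin⟩ := hb.resolve_left fun h => by
          rw [hf] at h
          exact one_ne_zero h.1
        have b3 : v * n + u₀ ≤ B := by have := index_lt v u₀; omega
        have hset : Program.wp B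
            (.block [.instr (.iadd 7 9 10), .instr (.rstore 3 7 2), .instr (.iconst 3 0)])
            (fun s' => Round I v 0 s' ∧ Holds (Paid I v (s.rreg 3) S
              (Function.update F (v * n + u₀) (I.demand v)) 0) s') s := by
          obtain ⟨⟨⟨h1, h2, h3, h4, h5, h6, h7, h8⟩, h9⟩, h10, h11, h12, h13⟩ := hr
          simp only [Program.block, Program.wp, Instr.wp, Function.update_apply, reduceIte,
            h11, hx, b3, zero_le, true_and, h12, hs3]
          exact ⟨⟨⟨⟨by simpa, by simpa, by simpa, by simpa, by simpa, by simpa, by simpa,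
            by simpa⟩, by simpa⟩, by simpa, by simpa, by simpa, by simp⟩, rfl, by simp,
            by simp [hs4]⟩
        refine Runs.mono (Q := Mid) ((Runs.of_wp hset).seq (t' := n * (40 + 1) + 1)
          fun s' hs' => ?_) (fun _ => id) (by simp only [Program.size, Program.block]; omega)
        refine (forCandidate_loop (c := 40) (C := Paid I v (s.rreg 3) S
          (Function.update F (v * n + u₀) (I.demand v))) hB (by decide)
          (fun j hj s hc hr hC hcap => pay_wp hj hc hr hC hcap) ?_ hs'.1 hs'.2).mono ?_ le_rfl
        · rintro j hj hc s ⟨h1, h2, h3⟩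
          refine ⟨h1, h2, fun u => (h3 u).trans ?_⟩
          have : ((u : ℕ) < j ∧ I.Candidate v u) ↔ ((u : ℕ) < j + 1 ∧ I.Candidate v u) := by
            refine and_congr_left fun hcu => ⟨fun hu => by omega, fun hu => ?_⟩
            by_contra hu'
            exact hc (hlast hj hu hu' ▸ hcu)
          rw [if_congr this rfl rfl]
        · rintro s'' ⟨hr', -, h2, h3⟩
          refine ⟨hr'.toReady, hr'.vertex, hsolves.succ hpos hc hp
            (fun u => hmin u u.2) (fun u => ?_) h2⟩
          rw [h3 u]
          simp only [u.2, true_and]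
      -- No vertex can serve `v`; it is passed over, so the program halts on infeasible instances
      -- too.
      · rw [Test.holds, hr.one] at hf
        have hno := (hb.resolve_right fun h => hf h.1).2
        refine Runs.skip ⟨hr.toReady, hr.vertex, ?_⟩ (by omega)
        rw [hs4, hs3]
        exact hsolves.succ_of_not fun ⟨_, u, hu⟩ => hno u u.2 hu
  · rw [Test.holds, h.ready.rzero, hd] at hpos
    exact Runs.skip ⟨h.ready, h.counter, h.solves.succ_of_not fun h => hpos h.1⟩ (by omega)
  · rintro s ⟨⟨⟨h1, h2, h3, h4, h5, h6, h7, h8⟩, h9⟩, h10, h11⟩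
    refine Runs.of_wp (P := .instr (.iadd 2 2 4)) ?_
    simp only [Program.wp, Instr.wp, h10, h2, b2, true_and]
    exact ⟨⟨⟨by simpa, by simpa, by simpa, by simpa, by simpa, by simpa, by simpa, by simpa⟩,
      by simpa⟩, by simp, by simpa⟩

theorem primalDualProgram_runs {I : Instance (Fin n)} {L : List (Fin n × Fin n)} {B : ℕ}
    (hL : IsEdgeList I.graph L) (hB : n * n + n + 1 ≤ B) :
    Runs B primalDualProgram (encode I L) (MainInv I n) (300 * (n ^ 2 + 1)) := by
  classical
  -- Absence of repetitions among the listed pairs already bounds the first loop; sparsity of the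
  -- graph is not needed.
  have hlen : L.length ≤ n * n := by
    have h1 : L.Nodup := List.Nodup.of_map _ hL.1
    have h2 := h1.length_le_card
    simpa using h2
  have hstart : Program.wp B (.block [.instr (.iconst 4 1), .instr (.rconst 1 (1 / 7))])
      (EdgeInv I L 0) (encode I L) := by
    have b1 : 1 ≤ B := by omega
    simp only [Program.block, Program.wp, Instr.wp, b1, true_and]
    refine ⟨⟨?_, ?_, ?_, ?_, ?_, ?_, ?_, ?_⟩, ?_, ?_, ?_, ?_, ?_, ?_⟩
    all_goals simp +contextual [encode]
    rfl
  refine Runs.mono (Q := MainInv I n) ((Runs.of_wp hstart).seq (Q' := MainInv I n)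
    (t' := 12 * n ^ 2 + 10 * n + 101 * (n * (n + 1)) + n + 10) fun s hs => ?_)
    (fun _ => id) (by simp only [Program.size, Program.block]; nlinarith [sq_nonneg ((n : ℤ) - 1)])
  refine Runs.mono (Q := MainInv I n) ((Runs.loop (N := L.length) (c := 10) (EdgeInv I L)
    (fun i s _ hs => by rw [Test.holds, hs.counter, hs.length]) (fun i s hi hs =>
      (Runs.of_wp (addEdge_wp hB (by omega) hs hi)).mono (fun _ => id) (by decide)) hs).seq
    (t' := 10 * n + 101 * (n * (n + 1)) + n + 5) fun s hs => ?_) (fun _ => id)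
    (by nlinarith)
  have hzero : Program.wp B (.instr (.iconst 2 0)) (VertexInv I 0) s := by
    obtain ⟨⟨h1, h2, h3, h4, h5, h6, h7, h8⟩, h9, h10, h11, h12, h13, h14⟩ := hs
    simp only [Program.wp, Instr.wp, zero_le, true_and]
    refine ⟨⟨by simpa, by simpa, by simpa, by simpa, by simpa, by simpa, by simpa, by simpa⟩,
      by simp, fun u v => ?_, by simp, by simpa⟩
    simp only [h13, List.take_length]
    refine if_congr ?_ rfl rfl
    rw [hL.2 u v, List.mem_map]
    simp
  refine Runs.mono (Q := MainInv I n) ((Runs.of_wp hzero).seq (Q' := MainInv I n)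
    (t' := 9 * n + 101 * (n * (n + 1)) + n + 4) fun s hs => ?_) (fun _ => id)
    (by simp only [Program.size]; omega)
  refine Runs.mono (Q := MainInv I n) ((Runs.loop (N := n) (c := 8) (VertexInv I)
    (fun i s _ hs => by rw [Test.holds, hs.counter, hs.env.size]) (fun i s hi hs =>
      (Runs.of_wp (addVertex_wp hB hs hi)).mono (fun _ => id) (by decide)) hs).seq
    (t' := 101 * (n * (n + 1)) + n + 2) fun s hs => ?_) (fun _ => id) (by omega)
  have hzero : Program.wp B (.instr (.iconst 2 0)) (MainInv I 0) s := by
    obtain ⟨⟨h1, h2, h3, h4, h5, h6, h7, h8⟩, h9, h10, h11, h12⟩ := hs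
    simp only [Program.wp, Instr.wp, zero_le, true_and]
    refine ⟨⟨⟨by simpa, by simpa, by simpa, by simpa, by simpa, by simpa, by simpa, by simpa⟩,
      -- No vertex has been served yet, so any `α` and `σ` will do.
      fun u v => ?_⟩, by simp, 0, id, ?_⟩
    · simp only [h10, u.2, and_true]
      refine if_congr ?_ rfl rfl
      rw [mem_closedNbhd, or_comm, eq_comm]
    · have : I.served 0 = ∅ := by simp [Instance.served]
      rw [this]
      refine ⟨.empty I _ _, fun u _ => ?_, fun u v => ?_⟩
      · rw [Instance.payment]
        simp [h11]
      · simp [h12, Instance.serve]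
  refine Runs.mono (Q := MainInv I n) ((Runs.of_wp hzero).seq (Q' := MainInv I n)
    (t' := n * (100 * (n + 1) + 1) + 1) fun s hs => ?_) (fun _ => id)
    (by simp only [Program.size]; nlinarith)
  exact Runs.loop (MainInv I) (fun i s _ hs => by rw [Test.holds, hs.counter, hs.ready.size])
    (fun i s hi hs => serveVertex_runs (v := ⟨i, hi⟩) hB hs) hs

end Correctness

end CapDom

/-! ### ### The approximation theorem -/

theorem mainTheorem2 :
    ∃ (P : CapDom.Program) (K : ℕ), ∀ (n : ℕ) (I : CapDom.Instance (Fin n))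
      (L : List (Fin n × Fin n)), CapDom.IsOuterplanar I.graph → CapDom.IsEdgeList I.graph L →
      ∃ (s : CapDom.State) (t : ℕ),
        CapDom.Exec ((n + 2) ^ K) P (CapDom.encode I L) s t ∧
        t ≤ K * (n ^ 2 + 1) ∧
        ((∃ g, I.IsFeasible g) →
          I.IsFeasible (CapDom.decode n s) ∧
          I.assignmentCost (CapDom.decode n s) ≤ 36 * I.OPT) := by
  -- The same constant bounds the time and is the exponent of the word bound; it is kept symbolic,
  -- and for the exponent only `2 ≤ K` matters.
  obtain ⟨K, hK⟩ : ∃ K, K = 300 := ⟨300, rfl⟩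
  refine ⟨CapDom.primalDualProgram, K, fun n I L hG hL => ?_⟩
  have hB : n * n + n + 1 ≤ (n + 2) ^ K := by
    calc n * n + n + 1 ≤ (n + 2) ^ 2 := by nlinarith
      _ ≤ (n + 2) ^ K := Nat.pow_le_pow_right (by omega) (by omega)
  obtain ⟨s, t, hexec, ht, -, -, α, σ, hpd, -, hout⟩ := CapDom.primalDualProgram_runs hL hB
  refine ⟨s, t, hexec, hK ▸ ht, ?_⟩
  have hdec : CapDom.decode n s = I.serve (I.served n) σ := by
    funext v u
    exact hout v u
  rw [hdec]
  rintro ⟨g₀, hg₀⟩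
  -- A vertex without a possible server has only capacity-0 vertices in its closed neighbourhood. A
  -- feasible assignment sends nothing to them, so its demand is 0.
  have hmem : ∀ v, 0 < I.demand v → v ∈ I.served n := by
    intro v hv
    simp only [CapDom.Instance.served, Finset.mem_filter, Finset.mem_univ, true_and, v.2, hv]
    by_contra! hno
    have hz : ∑ u ∈ CapDom.closedNbhd I.graph v, g₀ v u = 0 := by
      refine Finset.sum_eq_zero fun u hu => hg₀.cap_zero u ?_ v (CapDom.mem_closedNbhd_comm.1 hu)
      exact le_antisymm (not_lt.1 fun hc => hno u ⟨hu, hc⟩) (I.cap_nonneg u)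
    have := hg₀.demand_le v
    linarith
  refine ⟨hpd.isFeasible hmem, ?_⟩
  obtain ⟨O, hO, hadj⟩ := hG.exists_orientation
  have hub := hpd.assignmentCost_le hO hadj
  -- The two bounds give the factor `14 · 2 = 28`; nonnegativity of costs relaxes it to 36.
  have hopt : I.assignmentCost (I.serve (I.served n) σ) / 36 ≤ I.OPT := by
    refine le_csInf ⟨_, g₀, hg₀, rfl⟩ ?_
    rintro r ⟨g, hg, rfl⟩
    have h1 := hpd.sum_le hg
    have h2 : 0 ≤ I.assignmentCost g :=
      Finset.sum_nonneg fun v _ => mul_nonneg (I.cost_nonneg v) (Nat.cast_nonneg _)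
    linarith
  linarith
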